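/- Let $0<q<1$, put $[k]=\frac{1-q^k}{1-q}$ for integers $k\ge 1$, and for $r\ge 1$ let $$U_r=\{(s_1,\dots,s_r)\in\mathbb{C}^r:\ \mathrm{Re}(s_1+\dots+s_j)>0\ \text{for } j=1,\dots,r\}.$$ The $q$-multiple zeta function of depth $r$ (Schlesinger--Zudilin model) is defined on $U_r$ by the absolutely convergent series $$\zeta_q(s_1,\dots,s_r)=\sum_{k_1>\dots>k_r\ge 1}\frac{q^{k_1s_1+\dots+k_rs_r}}{[k_1]^{s_1}\cdots[k_r]^{s_r}}.$$ **Theorem.** Let $r\ge 2$. The function $\zeta_q(s_1,\dots,s_r)$ extends to a meromorphic function on $\mathbb{C}^r$ (and the function of depth $r-1$ extends to a meromorphic function on $\mathbb{C}^{r-1}$). The extensions, still denoted by $\zeta_q$, satisfy $$\sum_{k\ge 0}(-1)^k\frac{s_1(s_1+1)\cdots(s_1+k-1)}{k!}\,\zeta_q(s_1+s_2+k,s_3,\dots,s_r)$$ $$=\sum_{k\ge 0}(-1)^k\frac{s_1(s_1+1)\cdots(s_1+k)}{(k+1)!}\,\zeta_q(s_1+k+1,s_2,\dots,s_r)+(q^{-s_1}-1)\,\zeta_q(s_1,s_2,\dots,s_r)$$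 as meromorphic functions on $\mathbb{C}^r$; that is, at every point $(s_1,\dots,s_r)$ such that $\zeta_q$ is holomorphic at $(s_1+s_2+k,s_3,\dots,s_r)$ and at $(s_1+k,s_2,\dots,s_r)$ for all integers $k\ge 0$, both series converge absolutely and the identity holds. Both series converge normally on every compact subset of $U_r$. Moreover, on every compact subset $K$ of $\mathbb{C}^r$ they converge normally as series of meromorphic functions: all but finitely many of their terms are holomorphic in a neighbourhood of $K$, and the series of these remaining terms converges normally on $K$. -/

import Mathlib

namespace QMZV

noncomputable section

/-- The `q`-analogue `[k]_q = (1 - q^k) / (1 - q)` of a natural number `k`. -/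
def qNumber (q : ℝ) (k : ℕ) : ℝ := (1 - q ^ k) / (1 - q)

/-- The region `U_r` of all `s ∈ ℂ^r` with `Re (s_1 + ⋯ + s_j) > 0` for `j = 1, …, r`. -/
def region (r : ℕ) : Set (Fin r → ℂ) :=
  {s | ∀ j : Fin r, 0 < (∑ i ∈ Finset.Iic j, s i).re}

/-- The index set of the series: tuples of integers `k_1 > k_2 > ⋯ > k_r ≥ 1`. -/
abbrev Index (r : ℕ) : Type := {k : Fin r → ℕ // StrictAnti k ∧ ∀ i, 1 ≤ k i}

/-- The term `q^(k_1 s_1 + ⋯ + k_r s_r) / ([k_1]^{s_1} ⋯ [k_r]^{s_r})`. -/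
def term (q : ℝ) {r : ℕ} (s : Fin r → ℂ) (k : Index r) : ℂ :=
  (q : ℂ) ^ (∑ i, (k.1 i : ℂ) * s i) / ∏ i, ((qNumber q (k.1 i) : ℝ) : ℂ) ^ s i

/-- `f` is holomorphic at `p`: it is complex differentiable in a neighbourhood of `p`. -/
def HolomorphicAt {n : ℕ} (f : (Fin n → ℂ) → ℂ) (p : Fin n → ℂ) : Prop :=
  ∀ᶠ z in nhds p, DifferentiableAt ℂ f z

/-- `f` is a meromorphic function on `ℂ^n`: near each point it is a quotient `g / h` of
holomorphic functions, where `h` does not vanish identically near that point. The values of `f`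
on the thin set `h = 0` are irrelevant. -/
def Meromorphic {n : ℕ} (f : (Fin n → ℂ) → ℂ) : Prop :=
  ∀ p, ∃ g h : (Fin n → ℂ) → ℂ, HolomorphicAt g p ∧ HolomorphicAt h p ∧
    (∃ᶠ z in nhds p, h z ≠ 0) ∧ ∀ᶠ z in nhds p, h z ≠ 0 → f z = g z / h z

/-- `Z` is a meromorphic function on `ℂ^r` that extends the `q`-multiple zeta function of
depth `r`: on `U_r` the defining series converges (absolutely), with sum `Z s`. -/
def IsMeromorphicContinuation (q : ℝ) (r : ℕ) (Z : (Fin r → ℂ) → ℂ) : Prop :=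
  Meromorphic Z ∧ ∀ s ∈ region r, HasSum (term q s) (Z s)

/-- The series `∑ f k` converges normally on `K`: the sup norms of the `f k` on `K` are bounded
by the terms of a convergent series. -/
def NormallySummableOn {X : Type*} (f : ℕ → X → ℂ) (K : Set X) : Prop :=
  ∃ M : ℕ → ℝ, Summable M ∧ ∀ k, ∀ x ∈ K, ‖f k x‖ ≤ M k

/-- `(s_1 + k, s_2, …, s_r)`, where `r ≥ 2` is written as `r + 2`. -/
def shift {r : ℕ} (s : Fin (r + 2) → ℂ) (k : ℕ) : Fin (r + 2) → ℂ :=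
  Fin.cons (s 0 + k) (fun i : Fin (r + 1) => s i.succ)

/-- `(s_1 + s_2 + k, s_3, …, s_r)`, where `r ≥ 2` is written as `r + 2`. -/
def merge {r : ℕ} (s : Fin (r + 2) → ℂ) (k : ℕ) : Fin (r + 1) → ℂ :=
  Fin.cons (s 0 + s 1 + k) (fun i : Fin r => s i.succ.succ)

/-- The `k`-th term
`(-1)^k s_1 (s_1 + 1) ⋯ (s_1 + k - 1) / k! * ζ_q(s_1 + s_2 + k, s_3, …, s_r)`,
with `Z'` for the zeta function of depth one less. -/
def leftTerm {r : ℕ} (Z' : (Fin (r + 1) → ℂ) → ℂ) (k : ℕ) (s : Fin (r + 2) → ℂ) : ℂ :=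
  (-1) ^ k * (ascPochhammer ℂ k).eval (s 0) / (k.factorial : ℂ) * Z' (merge s k)

/-- The `k`-th term
`(-1)^k s_1 (s_1 + 1) ⋯ (s_1 + k) / (k + 1)! * ζ_q(s_1 + k + 1, s_2, …, s_r)`. -/
def rightTerm {r : ℕ} (Z : (Fin (r + 2) → ℂ) → ℂ) (k : ℕ) (s : Fin (r + 2) → ℂ) : ℂ :=
  (-1) ^ k * (ascPochhammer ℂ (k + 1)).eval (s 0) / ((k + 1).factorial : ℂ) * Z (shift s (k + 1))

end

end QMZV

/-! Write x = q^k/[k]. Raising the first argument by n multiplies a term of the series by x^n, with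
k = k_1, and 0 ≤ x ≤ q < 1. In the region of convergence the binomial series may therefore be summed
inside: the left side becomes the sum of (1+x)^(-s_1) times the terms at the merged argument, and
the right side becomes the sum of (q^(-s_1) - (1+x)^(-s_1)) times the terms at s
(`exists_hasSum_binomial`).

The rest is the identity [k+1] = [k](1+x) (`cpow_qNumber_succ`). It turns the factor at k_1 on the
right into q^((k_1-1)s_1)/[k_1]^(s_1) - q^(k_1 s_1)/[k_1+1]^(s_1). This telescopes over k_1 > k_2 to
q^(k_2 s_1)/[k_2+1]^(s_1), which is the factor on the left (`telescope_sub`,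
`translation_of_mem_region`).

The continuation comes from expanding each (1-q^k)^(-s) binomially and summing the geometric series
over the gaps between the k_i. The result is a series of products of q^w/(1-q^w), where w is a
partial sum of the s_i plus a natural number. Near a given point finitely many denominators can
vanish; once they are cleared, the series is holomorphic (`meromorphic_continuation`).

The factor x^n ≤ q^n also beats the binomial coefficients, and large shifts move any compact set
into the region, so both sides are normal series of meromorphic functions. Their difference vanishes
on the region, hence on a dense set, hence wherever it is continuous (`Meromorphic.dense_zeros`,
`translation_of_holomorphicAt`). -/

open Filter Topology

namespace QMZV

/-! ### Holomorphic functions on normed spaces, reduced to complex lines. -/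

section SeveralVariables

variable {E : Type*} [NormedAddCommGroup E] [NormedSpace ℂ E]

/-- Identity theorem on convex open sets, by restriction to complex lines. -/
theorem eqOn_zero_of_convex {f : E → ℂ} {U : Set E} (hU : IsOpen U) (hc : Convex ℝ U)
    (hf : DifferentiableOn ℂ f U) {a : E} (ha : a ∈ U) (h0 : ∀ᶠ z in 𝓝 a, f z = 0) :
    ∀ z ∈ U, f z = 0 := by
  intro b hb
  let l : ℂ → E := fun t => a + t • (b - a)
  have hl : Differentiable ℂ l := by fun_prop
  have hV : IsOpen (l ⁻¹' U) := hU.preimage hl.continuous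
  have hVc : Convex ℝ (l ⁻¹' U) := by
    intro x hx y hy α β hα hβ hαβ
    have : l (α • x + β • y) = α • l x + β • l y := by
      have h1 : α • a + β • a = a := by rw [← add_smul, hαβ, one_smul]
      simp only [l, add_smul, smul_add, smul_assoc]
      rw [add_add_add_comm, h1]
    show l _ ∈ U
    rw [this]
    exact hc hx hy hα hβ hαβ
  have hfl : DifferentiableOn ℂ (f ∘ l) (l ⁻¹' U) :=
    hf.comp hl.differentiableOn (fun _ h => h)
  have h1 : (f ∘ l) =ᶠ[𝓝 0] 0 := by
    have ht : Tendsto l (𝓝 0) (𝓝 a) := by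
      have := hl.continuous.tendsto 0
      simpa [l] using this
    exact ht.eventually h0
  have key := (hfl.analyticOnNhd hV).eqOn_zero_of_preconnected_of_eventuallyEq_zero
    hVc.isPreconnected (z₀ := 0) (by simpa [l] using ha) h1
  have := key (x := 1) (by simpa [l] using hb)
  simpa [l] using this

/-- Cauchy's estimate in one variable, on the complex line through x in each direction v. Half of
the radius is used so that the closed disc stays inside the open ball. -/
theorem norm_fderiv_le_of_ball {f : E → ℂ} {x : E} {ρ C : ℝ} (hρ : 0 < ρ)
    (hf : DifferentiableOn ℂ f (Metric.ball x ρ)) (hC : ∀ z ∈ Metric.ball x ρ, ‖f z‖ ≤ C) :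
    ‖fderiv ℂ f x‖ ≤ C / (ρ / 2) := by
  have hC0 : 0 ≤ C := (norm_nonneg _).trans (hC x (Metric.mem_ball_self hρ))
  refine ContinuousLinearMap.opNorm_le_bound _ (by positivity) fun v => ?_
  rcases eq_or_ne v 0 with rfl | hv
  · simp
  have hv0 : 0 < ‖v‖ := norm_pos_iff.2 hv
  let l : ℂ → E := fun t => x + t • v
  have hl : Differentiable ℂ l := by fun_prop
  have hmaps : Set.MapsTo l (Metric.closedBall 0 (ρ / 2 / ‖v‖)) (Metric.ball x ρ) := by
    intro t ht
    rw [mem_closedBall_zero_iff, le_div_iff₀ hv0] at ht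
    simp only [l, Metric.mem_ball, dist_self_add_left, norm_smul]
    linarith
  have hd : DifferentiableOn ℂ (f ∘ l) (Metric.closedBall 0 (ρ / 2 / ‖v‖)) :=
    hf.comp hl.differentiableOn hmaps
  have h1 := Complex.norm_deriv_le_of_forall_mem_sphere_norm_le (f := f ∘ l) (c := 0) (C := C)
    (R := ρ / 2 / ‖v‖) (by positivity)
    (DifferentiableOn.diffContOnCl (hd.mono Metric.closure_ball_subset_closedBall))
    (fun z hz => hC _ (hmaps (Metric.sphere_subset_closedBall hz)))
  have h2 : HasDerivAt (f ∘ l) (fderiv ℂ f x v) 0 := by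
    have hfx : HasFDerivAt f (fderiv ℂ f x) (l 0) := by
      have : l 0 = x := by simp [l]
      rw [this]
      exact (hf.differentiableAt (Metric.ball_mem_nhds x hρ)).hasFDerivAt
    have hl0 : HasDerivAt l v 0 := by
      simpa [l] using ((hasDerivAt_id (0 : ℂ)).smul_const v).const_add x
    exact hfx.comp_hasDerivAt 0 hl0
  rw [h2.deriv] at h1
  calc _ ≤ _ := h1
    _ = _ := by field_simp

/-- Weierstrass: a summable bound for the functions yields one for their derivatives by Cauchy's
estimate, at the price of halving the ball. -/
theorem differentiableOn_tsum_ball {ι : Type*} {f : ι → E → ℂ} {u : ι → ℝ} (hu : Summable u)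
    {p : E} {ρ : ℝ} (hρ : 0 < ρ) (hf : ∀ i, DifferentiableOn ℂ (f i) (Metric.ball p ρ))
    (hb : ∀ i, ∀ z ∈ Metric.ball p ρ, ‖f i z‖ ≤ u i) :
    DifferentiableOn ℂ (fun z => ∑' i, f i z) (Metric.ball p (ρ / 2)) := by
  have hsub : ∀ x ∈ Metric.ball p (ρ / 2), Metric.ball x (ρ / 2) ⊆ Metric.ball p ρ := by
    intro x hx
    apply Metric.ball_subset_ball'
    rw [Metric.mem_ball] at hx
    linarith
  intro x hx
  refine (hasFDerivAt_tsum_of_isPreconnected (𝕜 := ℂ) (u := fun i => u i / (ρ / 2 / 2))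
    (f' := fun i z => fderiv ℂ (f i) z) (x₀ := p)
    (hu.div_const _) Metric.isOpen_ball (convex_ball p (ρ / 2)).isPreconnected ?_ ?_
    (Metric.mem_ball_self (by positivity)) ?_ hx).differentiableAt.differentiableWithinAt
  · intro n z hz
    exact ((hf n).differentiableAt (Metric.isOpen_ball.mem_nhds
      (hsub z hz (Metric.mem_ball_self (by positivity))))).hasFDerivAt
  · intro n z hz
    exact norm_fderiv_le_of_ball (by positivity) ((hf n).mono (hsub z hz))
      (fun w hw => hb n w (hsub z hz hw))
  · exact hu.of_norm_bounded (fun i => hb i p (Metric.mem_ball_self hρ))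

theorem differentiableOn_prod {ι : Type*} {u : Finset ι} {f : ι → E → ℂ} {S : Set E}
    (hf : ∀ i ∈ u, DifferentiableOn ℂ (f i) S) :
    DifferentiableOn ℂ (fun x => ∏ i ∈ u, f i x) S := by
  classical
  induction u using Finset.induction_on with
  | empty => simp
  | insert i u hi ih =>
    simp only [Finset.prod_insert hi]
    exact (hf i (Finset.mem_insert_self i u)).fun_mul
      (ih fun j hj => hf j (Finset.mem_insert_of_mem hj))

end SeveralVariables

/-! ### Germs of holomorphic and meromorphic functions, and the identity theorem. -/

section HolomorphicAt

variable {n m : ℕ} {f g : (Fin n → ℂ) → ℂ} {p : Fin n → ℂ}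

theorem HolomorphicAt.differentiableAt (hf : HolomorphicAt f p) : DifferentiableAt ℂ f p :=
  hf.self_of_nhds

theorem HolomorphicAt.add (hf : HolomorphicAt f p) (hg : HolomorphicAt g p) :
    HolomorphicAt (fun z => f z + g z) p := by
  filter_upwards [hf, hg] with z h1 h2 using h1.fun_add h2

theorem HolomorphicAt.mul (hf : HolomorphicAt f p) (hg : HolomorphicAt g p) :
    HolomorphicAt (fun z => f z * g z) p := by
  filter_upwards [hf, hg] with z h1 h2 using h1.fun_mul h2

theorem HolomorphicAt.sum {ι : Type*} {s : Finset ι} {F : ι → (Fin n → ℂ) → ℂ}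
    (hF : ∀ i ∈ s, HolomorphicAt (F i) p) : HolomorphicAt (fun z => ∑ i ∈ s, F i z) p := by
  have : ∀ᶠ z in 𝓝 p, ∀ i ∈ s, DifferentiableAt ℂ (F i) z :=
    (Finset.eventually_all s).2 hF
  filter_upwards [this] with z hz using DifferentiableAt.fun_sum hz

theorem HolomorphicAt.congr (hf : HolomorphicAt f p) (h : f =ᶠ[𝓝 p] g) : HolomorphicAt g p := by
  filter_upwards [hf, h.eventually_nhds] with z h1 h2 using
    h1.congr_of_eventuallyEq (EventuallyEq.symm h2)

theorem HolomorphicAt.comp {φ : (Fin m → ℂ) → (Fin n → ℂ)} {x : Fin m → ℂ}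
    (hf : HolomorphicAt f (φ x)) (hφ : Differentiable ℂ φ) :
    HolomorphicAt (fun z => f (φ z)) x := by
  filter_upwards [(hφ.continuous.tendsto x).eventually hf] with z hz
  have hz' : DifferentiableAt ℂ f (φ z) := hz
  exact DifferentiableAt.comp z hz' (hφ z)

theorem _root_.Differentiable.holomorphicAt (hf : Differentiable ℂ f) : HolomorphicAt f p :=
  Eventually.of_forall hf

/-- The product of two holomorphic germs that are not identically zero is not identically zero. -/
theorem frequently_mul_ne_zero (hf : HolomorphicAt f p) (hg : HolomorphicAt g p)
    (hf0 : ∃ᶠ z in 𝓝 p, f z ≠ 0) (hg0 : ∃ᶠ z in 𝓝 p, g z ≠ 0) :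
    ∃ᶠ z in 𝓝 p, f z * g z ≠ 0 := by
  intro h
  obtain ⟨ρ, hρ, h1⟩ := Metric.eventually_nhds_iff_ball.1 (hf.and (hg.and h))
  have hfd : DifferentiableOn ℂ f (Metric.ball p ρ) :=
    fun z hz => (h1 z hz).1.differentiableWithinAt
  have hgd : DifferentiableOn ℂ g (Metric.ball p ρ) :=
    fun z hz => (h1 z hz).2.1.differentiableWithinAt
  obtain ⟨a, ha0, ha⟩ := (hf0.and_eventually (Metric.ball_mem_nhds p hρ)).exists
  have hga : ∀ᶠ z in 𝓝 a, g z = 0 := by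
    filter_upwards [(h1 a ha).1.continuousAt.eventually_ne ha0,
      Metric.isOpen_ball.mem_nhds ha] with z hz hzb
    have := (h1 z hzb).2.2
    simp only [ne_eq, mul_eq_zero, not_or, not_and, not_not] at this
    exact this hz
  have hz := eqOn_zero_of_convex Metric.isOpen_ball (convex_ball p ρ) hgd ha hga
  exact hg0 (by filter_upwards [Metric.ball_mem_nhds p hρ] with z hzb using not_not.2 (hz z hzb))

/-- `f` is locally at `p` a quotient of holomorphic functions. -/
def IsMeromorphicAt (f : (Fin n → ℂ) → ℂ) (p : Fin n → ℂ) : Prop :=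
  ∃ g h : (Fin n → ℂ) → ℂ, HolomorphicAt g p ∧ HolomorphicAt h p ∧
    (∃ᶠ z in 𝓝 p, h z ≠ 0) ∧ ∀ᶠ z in 𝓝 p, h z ≠ 0 → f z = g z / h z

theorem HolomorphicAt.isMeromorphicAt (hf : HolomorphicAt f p) : IsMeromorphicAt f p :=
  ⟨f, fun _ => 1, hf, (differentiable_const _).holomorphicAt,
    Frequently.of_forall (by simp), Eventually.of_forall (by simp)⟩

theorem IsMeromorphicAt.add (hf : IsMeromorphicAt f p) (hg : IsMeromorphicAt g p) :
    IsMeromorphicAt (fun z => f z + g z) p := by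
  obtain ⟨a, b, ha, hb, hb0, hab⟩ := hf
  obtain ⟨c, d, hc, hd, hd0, hcd⟩ := hg
  refine ⟨fun z => a z * d z + c z * b z, fun z => b z * d z, (ha.mul hd).add (hc.mul hb),
    hb.mul hd, frequently_mul_ne_zero hb hd hb0 hd0, ?_⟩
  filter_upwards [hab, hcd] with z h1 h2 h3
  have hb1 := left_ne_zero_of_mul h3
  have hd1 := right_ne_zero_of_mul h3
  rw [h1 hb1, h2 hd1]
  field_simp

theorem IsMeromorphicAt.mul (hf : IsMeromorphicAt f p) (hg : IsMeromorphicAt g p) :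
    IsMeromorphicAt (fun z => f z * g z) p := by
  obtain ⟨a, b, ha, hb, hb0, hab⟩ := hf
  obtain ⟨c, d, hc, hd, hd0, hcd⟩ := hg
  refine ⟨fun z => a z * c z, fun z => b z * d z, ha.mul hc,
    hb.mul hd, frequently_mul_ne_zero hb hd hb0 hd0, ?_⟩
  filter_upwards [hab, hcd] with z h1 h2 h3
  rw [h1 (left_ne_zero_of_mul h3), h2 (right_ne_zero_of_mul h3), div_mul_div_comm]

theorem IsMeromorphicAt.sum {ι : Type*} {s : Finset ι} {F : ι → (Fin n → ℂ) → ℂ}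
    (hF : ∀ i ∈ s, IsMeromorphicAt (F i) p) : IsMeromorphicAt (fun z => ∑ i ∈ s, F i z) p := by
  classical
  induction s using Finset.induction_on with
  | empty => simpa using (differentiable_const (0 : ℂ)).holomorphicAt.isMeromorphicAt
  | insert i s hi ih =>
    simp only [Finset.sum_insert hi]
    exact (hF i (Finset.mem_insert_self i s)).add
      (ih fun j hj => hF j (Finset.mem_insert_of_mem hj))

/-- Pull-back along a holomorphic map that has a continuous section through `x`. -/
theorem IsMeromorphicAt.comp {φ : (Fin m → ℂ) → (Fin n → ℂ)} {σ : (Fin n → ℂ) → (Fin m → ℂ)}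
    {x : Fin m → ℂ} (hf : IsMeromorphicAt f (φ x)) (hφ : Differentiable ℂ φ)
    (hσ : Continuous σ) (hσx : σ (φ x) = x) (hφσ : ∀ w, φ (σ w) = w) :
    IsMeromorphicAt (fun z => f (φ z)) x := by
  obtain ⟨a, b, ha, hb, hb0, hab⟩ := hf
  refine ⟨_, _, ha.comp hφ, hb.comp hφ, ?_, (hφ.continuous.tendsto x).eventually hab⟩
  intro h
  apply hb0
  have ht : Tendsto σ (𝓝 (φ x)) (𝓝 x) := by simpa [hσx] using hσ.tendsto (φ x)
  filter_upwards [ht.eventually h] with w hw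
  simpa [hφσ] using hw

/-- Identity theorem: a meromorphic function on `ℂ^n` that vanishes on a nonempty open set
vanishes on a dense set. -/
theorem Meromorphic.dense_zeros (hf : Meromorphic f) {U : Set (Fin n → ℂ)} (hU : IsOpen U)
    (hne : U.Nonempty) (h0 : ∀ z ∈ U, f z = 0) : Dense {z | f z = 0} := by
  set W : Set (Fin n → ℂ) := interior {z | f z = 0} with hW
  have hUW : U ⊆ W := interior_maximal h0 hU
  -- The closure of the interior of the zero set is shown to be open; connectedness of the whole
  -- space then finishes the proof.
  have hopen : IsOpen (closure W) := by
    rw [isOpen_iff_mem_nhds]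
    intro p hp
    obtain ⟨a, b, ha, hb, hb0, hab⟩ := hf p
    obtain ⟨ρ, hρ, h1⟩ := Metric.eventually_nhds_iff_ball.1 (ha.and (hb.and hab))
    have had : DifferentiableOn ℂ a (Metric.ball p ρ) :=
      fun z hz => (h1 z hz).1.differentiableWithinAt
    have hbd : DifferentiableOn ℂ b (Metric.ball p ρ) :=
      fun z hz => (h1 z hz).2.1.differentiableWithinAt
    have hbne : ∀ c ∈ Metric.ball p ρ, ∃ᶠ z in 𝓝 c, b z ≠ 0 := by
      intro c hc h
      have hz := eqOn_zero_of_convex Metric.isOpen_ball (convex_ball p ρ) hbd hc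
        (by simpa using h)
      exact hb0 (by
        filter_upwards [Metric.ball_mem_nhds p hρ] with z hzb using not_not.2 (hz z hzb))
    obtain ⟨c, hcB, hcW⟩ := mem_closure_iff_nhds.1 hp _ (Metric.ball_mem_nhds p hρ)
    -- Move c slightly, within W, to a point where the denominator does not vanish; there the
    -- vanishing of f forces the numerator to vanish.
    obtain ⟨d, hd0, hdB, hdW⟩ := ((hbne c hcB).and_eventually (inter_mem
      (Metric.isOpen_ball.mem_nhds hcB) (isOpen_interior.mem_nhds hcW))).exists
    have ha0 : ∀ᶠ z in 𝓝 d, a z = 0 := by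
      filter_upwards [(h1 d hdB).2.1.continuousAt.eventually_ne hd0,
        Metric.isOpen_ball.mem_nhds hdB, isOpen_interior.mem_nhds hdW] with z hz hzB hzW
      have h2 : f z = 0 := interior_subset (s := {z | f z = 0}) hzW
      have h3 := (h1 z hzB).2.2 hz
      rw [h2, eq_comm, div_eq_zero_iff] at h3
      exact h3.resolve_right hz
    have hza := eqOn_zero_of_convex Metric.isOpen_ball (convex_ball p ρ) had hdB ha0
    have hfz : ∀ z ∈ Metric.ball p ρ, b z ≠ 0 → z ∈ W := by
      intro z hz hbz
      rw [hW, mem_interior_iff_mem_nhds]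
      filter_upwards [(h1 z hz).2.1.continuousAt.eventually_ne hbz,
        Metric.isOpen_ball.mem_nhds hz] with w hw hwB
      show f w = 0
      rw [(h1 w hwB).2.2 hw, hza w hwB, zero_div]
    filter_upwards [Metric.ball_mem_nhds p hρ] with z hz
    rw [mem_closure_iff_frequently]
    exact ((hbne z hz).and_eventually (Metric.isOpen_ball.mem_nhds hz)).mono
      fun w hw => hfz w hw.2 hw.1
  have hclopen : IsClopen (closure W) := ⟨isClosed_closure, hopen⟩
  have huniv : closure W = Set.univ :=
    hclopen.eq_univ ((hne.mono hUW).closure)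
  exact (dense_iff_closure_eq.2 huniv).mono interior_subset

end HolomorphicAt

/-! ### Normally convergent series of meromorphic functions. -/

section NormalSeries

variable {n : ℕ} {F : ℕ → (Fin n → ℂ) → ℂ}

/-- Normal convergence on compact sets as a series of meromorphic functions. -/
def IsNormalSeries (F : ℕ → (Fin n → ℂ) → ℂ) : Prop :=
  ∀ K : Set (Fin n → ℂ), IsCompact K → ∃ k₀ : ℕ,
    (∀ k, k₀ ≤ k → ∀ s ∈ K, HolomorphicAt (F k) s) ∧ NormallySummableOn (fun k => F (k₀ + k)) K

/-- Finitely many terms never affect summability, so this holds even at poles, where the values of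
those terms are arbitrary. -/
theorem IsNormalSeries.summable (hF : IsNormalSeries F) (s : Fin n → ℂ) :
    Summable fun k => F k s := by
  obtain ⟨k₀, -, M, hM, hb⟩ := hF {s} isCompact_singleton
  refine (summable_nat_add_iff k₀).1 (hM.of_norm_bounded fun k => ?_)
  simpa [add_comm] using hb k s rfl

/-- Reduces local properties of the sum to those of finitely many terms, by the Weierstrass theorem
on a unit ball around p. -/
theorem IsNormalSeries.exists_tail (hF : IsNormalSeries F) (p : Fin n → ℂ) :
    ∃ k₀ : ℕ, ∃ T : (Fin n → ℂ) → ℂ, HolomorphicAt T p ∧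
      ∀ s, ∑' k, F k s = ∑ k ∈ Finset.range k₀, F k s + T s := by
  obtain ⟨k₀, hhol, M, hM, hb⟩ := hF (Metric.closedBall p 1) (isCompact_closedBall p 1)
  refine ⟨k₀, fun s => ∑' k, F (k₀ + k) s, ?_, fun s => ?_⟩
  · have := differentiableOn_tsum_ball hM (p := p) one_pos (f := fun k => F (k₀ + k))
      (fun k z hz => (hhol (k₀ + k) (Nat.le_add_right _ _) z
        (Metric.ball_subset_closedBall hz)).differentiableAt.differentiableWithinAt)
      (fun k z hz => hb k z (Metric.ball_subset_closedBall hz))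
    filter_upwards [Metric.isOpen_ball.mem_nhds
      (Metric.mem_ball_self (x := p) (half_pos one_pos))] with z hz
    exact this.differentiableAt (Metric.isOpen_ball.mem_nhds hz)
  · rw [← (hF.summable s).sum_add_tsum_nat_add k₀]
    simp only [add_comm]

theorem IsNormalSeries.holomorphicAt_tsum (hF : IsNormalSeries F) {p : Fin n → ℂ}
    (h : ∀ k, HolomorphicAt (F k) p) : HolomorphicAt (fun s => ∑' k, F k s) p := by
  obtain ⟨k₀, T, hT, heq⟩ := hF.exists_tail p
  simp only [heq]
  exact (HolomorphicAt.sum fun k _ => h k).add hT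

theorem IsNormalSeries.isMeromorphicAt_tsum (hF : IsNormalSeries F) {p : Fin n → ℂ}
    (h : ∀ k, IsMeromorphicAt (F k) p) : IsMeromorphicAt (fun s => ∑' k, F k s) p := by
  obtain ⟨k₀, T, hT, heq⟩ := hF.exists_tail p
  simp only [heq]
  exact (IsMeromorphicAt.sum fun k _ => h k).add hT.isMeromorphicAt

end NormalSeries

noncomputable section

/-! ### Partial sums of the arguments under shifting and merging. -/

section PartialSums

variable {r : ℕ}

theorem sum_Iic_succ {A : Type*} [AddCommMonoid A] {n : ℕ} (x : Fin (n + 1) → A) (j : Fin n) :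
    ∑ i ∈ Finset.Iic j.succ, x i = x 0 + ∑ i ∈ Finset.Iic j, x i.succ := by
  have : Finset.Iic j.succ = insert 0 ((Finset.Iic j).map (Fin.succEmb n)) := by
    ext i
    refine Fin.cases ?_ (fun i => ?_) i
    · simp
    · simp
  rw [this, Finset.sum_insert (by simp), Finset.sum_map]
  rfl

theorem shift_apply (s : Fin (r + 2) → ℂ) (k : ℕ) (i : Fin (r + 2)) :
    shift s k i = s i + if i = 0 then (k : ℂ) else 0 := by
  refine Fin.cases ?_ (fun i => ?_) i <;> simp [shift]

theorem merge_apply (s : Fin (r + 2) → ℂ) (k : ℕ) (i : Fin (r + 1)) :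
    merge s k i = s i.succ + if i = 0 then s 0 + k else 0 := by
  refine Fin.cases ?_ (fun i => ?_) i
  · simp [merge]; ring
  · simp [merge, Fin.succ_ne_zero]

@[simp] theorem shift_zero (s : Fin (r + 2) → ℂ) : shift s 0 = s := by
  ext i; simp [shift_apply]

theorem sum_Iic_shift (s : Fin (r + 2) → ℂ) (k : ℕ) (j : Fin (r + 2)) :
    ∑ i ∈ Finset.Iic j, shift s k i = ∑ i ∈ Finset.Iic j, s i + k := by
  simp [shift_apply, Finset.sum_add_distrib]

theorem sum_Iic_merge (s : Fin (r + 2) → ℂ) (k : ℕ) (j : Fin (r + 1)) :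
    ∑ i ∈ Finset.Iic j, merge s k i = ∑ i ∈ Finset.Iic j.succ, s i + k := by
  simp only [merge_apply, Finset.sum_add_distrib, sum_Iic_succ]
  simp; ring

theorem norm_sum_Iic_le {R : ℝ} (hR : 0 ≤ R) {s : Fin r → ℂ} (hs : ∀ i, ‖s i‖ ≤ R) (j : Fin r) :
    ‖∑ i ∈ Finset.Iic j, s i‖ ≤ r * R := by
  refine (norm_sum_le_of_le _ fun i _ => hs i).trans ?_
  rw [Finset.sum_const, nsmul_eq_mul]
  refine mul_le_mul_of_nonneg_right ?_ hR
  exact_mod_cast (Finset.card_le_univ _).trans (Fintype.card_fin r).le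

theorem isOpen_region (r : ℕ) : IsOpen (region r) := by
  simp only [region, Set.ofPred_forall]
  exact isOpen_iInter_of_finite fun j => isOpen_lt continuous_const (by fun_prop)

theorem nonempty_region (r : ℕ) : (region r).Nonempty := by
  refine ⟨fun _ => 1, fun j => ?_⟩
  simp only [Finset.sum_const, nsmul_eq_mul, mul_one, Complex.natCast_re, Nat.cast_pos]
  exact Finset.card_pos.2 ⟨j, Finset.mem_Iic.2 le_rfl⟩

theorem shift_mem_region {s : Fin (r + 2) → ℂ} (hs : s ∈ region (r + 2)) (k : ℕ) :
    shift s k ∈ region (r + 2) := by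
  intro j
  rw [sum_Iic_shift, Complex.add_re, Complex.natCast_re]
  have := hs j
  positivity

theorem merge_mem_region {s : Fin (r + 2) → ℂ} (hs : s ∈ region (r + 2)) (k : ℕ) :
    merge s k ∈ region (r + 1) := by
  intro j
  rw [sum_Iic_merge, Complex.add_re, Complex.natCast_re]
  have := hs j.succ
  positivity

theorem merge_add (s : Fin (r + 2) → ℂ) (k l : ℕ) :
    merge s (k + l) = fun i => merge s k i + if i = 0 then (l : ℂ) else 0 := by
  ext i
  simp only [merge_apply]
  split_ifs <;> push_cast <;> ring

theorem shift_add (s : Fin (r + 2) → ℂ) (k l : ℕ) :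
    shift s (k + l) = fun i => shift s k i + if i = 0 then (l : ℂ) else 0 := by
  ext i
  simp only [shift_apply]
  split_ifs <;> push_cast <;> ring

end PartialSums

/-! ### Decreasing index tuples, parametrized by their gaps. -/

section Index

variable {r : ℕ}

/-- The exponent `k_1 s_1 + ⋯ + k_r s_r`. -/
def pairing (s : Fin r → ℂ) (k : Index r) : ℂ := ∑ i, (k.1 i : ℂ) * s i

/-- Adjoin a new largest entry `k_1 + 1 + m` to `k`. -/
def Index.cons (m : ℕ) (k : Index (r + 1)) : Index (r + 2) :=
  ⟨Fin.cons (k.1 0 + 1 + m) k.1, by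
    refine Fin.strictAnti_iff_succ_lt.2 fun i => ?_
    refine Fin.cases ?_ (fun i => ?_) i
    · simp; omega
    · rw [Fin.cons_succ, ← Fin.succ_castSucc, Fin.cons_succ]
      exact k.2.1 Fin.castSucc_lt_succ, by
    intro i
    refine Fin.cases ?_ (fun i => ?_) i
    · simp; omega
    · simpa using k.2.2 i⟩

/-- Splitting off the largest entry. -/
def Index.consEquiv (r : ℕ) : ℕ × Index (r + 1) ≃ Index (r + 2) where
  toFun p := Index.cons p.1 p.2
  invFun k := (k.1 0 - k.1 1 - 1, ⟨fun i => k.1 i.succ,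
    fun _ _ h => k.2.1 (Fin.succ_lt_succ_iff.2 h), fun i => k.2.2 i.succ⟩)
  left_inv p := by
    rcases p with ⟨m, k⟩
    refine Prod.ext ?_ (Subtype.ext ?_)
    · have : (1 : Fin (r + 2)) = Fin.succ 0 := rfl
      simp only [Index.cons, this, Fin.cons_succ, Fin.cons_zero]
      omega
    · ext i
      simp [Index.cons]
  right_inv k := by
    refine Subtype.ext (funext fun i => ?_)
    refine Fin.cases ?_ (fun i => ?_) i
    -- Strict decrease makes the truncated subtraction in the inverse map exact.
    · have h : k.1 1 < k.1 0 := k.2.1 (by simp)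
      have h1 : (1 : Fin (r + 2)) = Fin.succ 0 := rfl
      rw [h1] at h
      simp only [Index.cons, Fin.cons_zero, h1]
      omega
    · simp [Index.cons]

/-- Indices of depth one are the positive integers. -/
def Index.oneEquiv : ℕ ≃ Index 1 where
  toFun m := ⟨fun _ => m + 1, fun i j h => absurd h (by simp [Subsingleton.elim i j]),
    fun i => Nat.succ_le_succ (Nat.zero_le m)⟩
  invFun k := k.1 0 - 1
  left_inv m := by simp
  right_inv k := by
    refine Subtype.ext (funext fun i => ?_)
    have := k.2.2 0
    rw [Subsingleton.elim i 0]
    simp only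
    omega

/-- Since k_1 = k_2 + 1 + m, the part k_2 s_1 of k_1 s_1 is absorbed into the next argument, which
becomes s_1 + s_2. -/
theorem pairing_cons (s : Fin (r + 2) → ℂ) (m : ℕ) (k : Index (r + 1)) :
    pairing s (Index.cons m k) = (1 + m) * s 0 + pairing (merge s 0) k := by
  simp only [pairing, Index.cons, merge_apply, mul_add, Finset.sum_add_distrib]
  rw [Fin.sum_univ_succ]
  simp
  ring

theorem pairing_oneEquiv (s : Fin 1 → ℂ) (m : ℕ) :
    pairing s (Index.oneEquiv m) = (1 + m) * s 0 := by
  simp [pairing, Index.oneEquiv, add_comm]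

/-- Abel summation: a decreasing weighting of nonnegative partial sums is nonnegative. -/
theorem pairing_re_nonneg {s : Fin (r + 1) → ℂ}
    (hs : ∀ j, 0 ≤ (∑ i ∈ Finset.Iic j, s i).re) (k : Index (r + 1)) :
    0 ≤ (pairing s k).re := by
  induction r with
  | zero =>
    obtain ⟨m, rfl⟩ := Index.oneEquiv.surjective k
    have h := hs 0
    rw [pairing_oneEquiv, show (1 : ℂ) + m = ((1 + m : ℝ) : ℂ) by push_cast; rfl,
      Complex.re_ofReal_mul]
    have : Finset.Iic (0 : Fin 1) = {0} := rfl
    rw [this, Finset.sum_singleton] at h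
    positivity
  | succ r ih =>
    obtain ⟨⟨m, k⟩, rfl⟩ := (Index.consEquiv r).surjective k
    have h := hs 0
    have h0 : Finset.Iic (0 : Fin (r + 2)) = {0} := rfl
    rw [h0, Finset.sum_singleton] at h
    have := ih (s := merge s 0) (fun j => by
      rw [sum_Iic_merge]; simpa using hs j.succ) k
    show 0 ≤ (pairing s (Index.cons m k)).re
    rw [pairing_cons, show (1 : ℂ) + m = ((1 + m : ℝ) : ℂ) by push_cast; rfl, Complex.add_re,
      Complex.re_ofReal_mul]
    positivity

theorem pairing_re_mono {s t : Fin (r + 1) → ℂ}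
    (h : ∀ j, (∑ i ∈ Finset.Iic j, s i).re ≤ (∑ i ∈ Finset.Iic j, t i).re) (k : Index (r + 1)) :
    (pairing s k).re ≤ (pairing t k).re := by
  have := pairing_re_nonneg (s := t - s) (fun j => by
    simp only [Pi.sub_apply, Finset.sum_sub_distrib, Complex.sub_re, sub_nonneg]
    exact h j) k
  simpa only [pairing, Pi.sub_apply, mul_sub, Finset.sum_sub_distrib, Complex.sub_re,
    sub_nonneg] using this

end Index

/-! ### Geometric sums over the index set. -/

section Sums

theorem norm_qpow {q : ℝ} (hq0 : 0 < q) (w : ℂ) : ‖(q : ℂ) ^ w‖ = q ^ w.re :=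
  Complex.norm_cpow_eq_rpow_re_of_pos hq0 w

theorem norm_qpow_lt_one {q : ℝ} (hq0 : 0 < q) (hq1 : q < 1) {w : ℂ} (hw : 0 < w.re) :
    ‖(q : ℂ) ^ w‖ < 1 := by
  rw [norm_qpow hq0]
  exact Real.rpow_lt_one hq0.le hq1 hw

theorem hasSum_qpow {q : ℝ} (hq0 : 0 < q) (hq1 : q < 1) {w : ℂ} (hw : 0 < w.re) :
    HasSum (fun m : ℕ => (q : ℂ) ^ ((1 + m) * w)) ((q : ℂ) ^ w / (1 - (q : ℂ) ^ w)) := by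
  have hq : (q : ℂ) ≠ 0 := by exact_mod_cast hq0.ne'
  have := (hasSum_geometric_of_norm_lt_one (norm_qpow_lt_one hq0 hq1 hw)).mul_left ((q : ℂ) ^ w)
  rw [← div_eq_mul_inv] at this
  have e : (fun m : ℕ => (q : ℂ) ^ ((1 + m) * w)) = fun m => (q : ℂ) ^ w * ((q : ℂ) ^ w) ^ m := by
    ext m
    rw [add_mul, one_mul, Complex.cpow_add _ _ hq, Complex.cpow_nat_mul]
  rwa [e]

theorem hasSum_mul_complex {ι κ : Type*} {f : ι → ℂ} {g : κ → ℂ} {a b : ℂ} (hf : HasSum f a)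
    (hg : HasSum g b) : HasSum (fun p : ι × κ => f p.1 * g p.2) (a * b) := by
  have h := summable_mul_of_summable_norm hf.summable.norm hg.summable.norm
  exact HasSum.mul hf hg h

/-- In terms of the gaps the exponent decouples: the j-th gap carries the j-th partial sum of s. The
series is thus a product of geometric series, which is why the region is defined by partial sums. -/
theorem hasSum_qpow_pairing {q : ℝ} (hq0 : 0 < q) (hq1 : q < 1) {r : ℕ} {s : Fin (r + 1) → ℂ}
    (hs : s ∈ region (r + 1)) :
    HasSum (fun k : Index (r + 1) => (q : ℂ) ^ pairing s k)
      (∏ j, (q : ℂ) ^ (∑ i ∈ Finset.Iic j, s i) / (1 - (q : ℂ) ^ (∑ i ∈ Finset.Iic j, s i))) := by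
  have hq : (q : ℂ) ≠ 0 := by exact_mod_cast hq0.ne'
  have h0 : ∀ n, Finset.Iic (0 : Fin (n + 1)) = {0} := fun n => rfl
  induction r with
  | zero =>
    rw [← Index.oneEquiv.hasSum_iff]
    have h := hs 0
    rw [h0, Finset.sum_singleton] at h
    simpa [Function.comp_def, pairing_oneEquiv, h0] using hasSum_qpow hq0 hq1 h
  | succ r ih =>
    rw [← (Index.consEquiv r).hasSum_iff]
    have h := hs 0
    rw [h0, Finset.sum_singleton] at h
    have h1 := hasSum_qpow hq0 hq1 h
    have h2 := ih (merge_mem_region hs 0)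
    have h3 := hasSum_mul_complex h1 h2
    rw [Fin.prod_univ_succ, h0, Finset.sum_singleton]
    simp only [sum_Iic_merge, Nat.cast_zero, add_zero] at h3
    convert h3 using 1
    ext ⟨m, k⟩
    simp [Index.consEquiv, pairing_cons, Complex.cpow_add _ _ hq]

theorem hasSum_pi_prod {d : ℕ} {f : Fin d → ℕ → ℂ} {a : Fin d → ℂ}
    (h : ∀ i, HasSum (f i) (a i)) :
    HasSum (fun n : Fin d → ℕ => ∏ i, f i (n i)) (∏ i, a i) := by
  induction d with
  | zero => simp
  | succ d ih =>
    rw [← (Fin.consEquiv (fun _ : Fin (d + 1) => ℕ)).hasSum_iff, Fin.prod_univ_succ]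
    have h2 := ih fun i => h i.succ
    have h3 := hasSum_mul_complex (h 0) h2
    convert h3 using 1
    ext ⟨m, n⟩
    simp [Fin.prod_univ_succ, Fin.consEquiv]

end Sums

/-! ### Binomial series and bounds for their coefficients. -/

section Binomial

/-- The coefficient `a (a + 1) ⋯ (a + n - 1) / n!` of the binomial series of `(1 - x) ^ (-a)`. -/
def coef (a : ℂ) (n : ℕ) : ℂ := (ascPochhammer ℂ n).eval a / (n.factorial : ℂ)

theorem hasSum_coef (a : ℂ) {x : ℂ} (hx : ‖x‖ < 1) :
    HasSum (fun n => coef a n * x ^ n) ((1 - x) ^ (-a)) := by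
  have h := (Complex.one_div_one_sub_cpow_hasFPowerSeriesOnBall_zero a).hasSum (y := x)
    (by simpa [← ofReal_norm] using hx)
  simp only [zero_add, one_div, ← Complex.cpow_neg] at h
  -- Both are the generalized multichoose number of a and n.
  have e : ∀ n, coef a n = Ring.choose (a + n - 1) n := by
    intro n
    have := Ring.factorial_nsmul_multichoose_eq_ascPochhammer a n
    rw [Polynomial.ascPochhammer_smeval_eq_eval, nsmul_eq_mul] at this
    rw [← Ring.multichoose_eq, coef, ← this,
      mul_div_cancel_left₀ _ (Nat.cast_ne_zero.2 n.factorial_ne_zero)]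
  simpa [e, mul_comm] using h

/-- Factor by factor, |a + n| ≤ R + n, with equality at a = R; this makes majorants uniform on
bounded sets. -/
theorem norm_coef_le {a : ℂ} {R : ℝ} (h : ‖a‖ ≤ R) (n : ℕ) : ‖coef a n‖ ≤ ‖coef R n‖ := by
  have hR : 0 ≤ R := (norm_nonneg a).trans h
  simp only [coef, norm_div]
  gcongr
  induction n with
  | zero => simp
  | succ n ih =>
    simp only [ascPochhammer_succ_eval, norm_mul]
    have h1 : ‖(R : ℂ) + n‖ = R + n := by
      rw [show (R : ℂ) + n = ((R + n : ℝ) : ℂ) by push_cast; rfl, Complex.norm_real,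
        Real.norm_of_nonneg (by positivity)]
    have h2 : ‖a + n‖ ≤ R + n := (norm_add_le _ _).trans (by simpa using h)
    rw [h1]
    gcongr

theorem summable_norm_coef_mul_pow (a : ℂ) {x : ℝ} (h0 : 0 ≤ x) (h1 : x < 1) :
    Summable fun n => ‖coef a n‖ * x ^ n := by
  have := (hasSum_coef a (x := x) (by simpa [abs_of_nonneg h0] using h1)).summable.norm
  simpa [abs_of_nonneg h0] using this

theorem differentiable_coef (n : ℕ) : Differentiable ℂ fun a => coef a n := by
  unfold coef
  exact (Polynomial.differentiable _).div_const _

end Binomial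

/-! ### Bounds and recursion for q-numbers. -/

section QNumber

theorem one_le_qNumber {q : ℝ} (hq0 : 0 < q) (hq1 : q < 1) {k : ℕ} (hk : 1 ≤ k) :
    1 ≤ qNumber q k := by
  rw [qNumber, le_div_iff₀ (by linarith)]
  have : q ^ k ≤ q ^ 1 := pow_le_pow_of_le_one hq0.le hq1.le hk
  linarith

theorem qNumber_le {q : ℝ} (hq0 : 0 < q) (hq1 : q < 1) (k : ℕ) :
    qNumber q k ≤ 1 / (1 - q) := by
  have : 0 < 1 - q := by linarith
  rw [qNumber]
  gcongr
  linarith [pow_pos hq0 k]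

theorem qNumber_succ {q : ℝ} (hq1 : q < 1) (k : ℕ) :
    qNumber q (k + 1) = qNumber q k + q ^ k := by
  have : 1 - q ≠ 0 := by linarith
  simp only [qNumber]
  field_simp
  ring

theorem pow_div_qNumber_nonneg {q : ℝ} (hq0 : 0 < q) (hq1 : q < 1) {k : ℕ} (hk : 1 ≤ k) :
    0 ≤ q ^ k / qNumber q k := by
  have := one_le_qNumber hq0 hq1 hk
  positivity

theorem pow_div_qNumber_le {q : ℝ} (hq0 : 0 < q) (hq1 : q < 1) {k : ℕ} (hk : 1 ≤ k) :
    q ^ k / qNumber q k ≤ q := by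
  have h := one_le_qNumber hq0 hq1 hk
  have h2 : q ^ k ≤ q := by simpa using pow_le_pow_of_le_one hq0.le hq1.le hk
  rw [div_le_iff₀ (by linarith)]
  nlinarith

end QNumber

/-! ### Terms of the series: majorants and translation of the first argument. -/

section Term

variable {r : ℕ}

theorem differentiable_pairing (k : Index r) :
    Differentiable ℂ fun s : Fin r → ℂ => pairing s k := by
  unfold pairing
  fun_prop

theorem differentiable_term {q : ℝ} (hq0 : 0 < q) (hq1 : q < 1) (k : Index r) :
    Differentiable ℂ fun s => term q s k := by
  have hq : (q : ℂ) ≠ 0 := by exact_mod_cast hq0.ne'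
  have hk : ∀ i, ((qNumber q (k.1 i) : ℝ) : ℂ) ≠ 0 := fun i => by
    exact_mod_cast (zero_lt_one.trans_le (one_le_qNumber hq0 hq1 (k.2.2 i))).ne'
  have hd : ∀ i ∈ Finset.univ, Differentiable ℂ
      fun s : Fin r → ℂ => ((qNumber q (k.1 i) : ℝ) : ℂ) ^ s i := fun i _ => by
    have hi : Differentiable ℂ fun s : Fin r → ℂ => s i := differentiable_apply i
    exact hi.const_cpow (Or.inl (hk i))
  simp only [term, div_eq_mul_inv]
  refine Differentiable.fun_mul ((differentiable_pairing k).const_cpow (Or.inl hq))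
    (Differentiable.fun_inv (differentiableOn_univ.1
      (differentiableOn_prod fun i hi => (hd i hi).differentiableOn)) fun s => ?_)
  exact Finset.prod_ne_zero_iff.2 fun i _ => by simp [Complex.cpow_eq_zero_iff, hk i]

/-- As 1 ≤ [k] ≤ 1/(1-q), the denominators matter only up to a constant on bounded sets, and
convergence is decided by the power of q. -/
theorem norm_term_le {q : ℝ} (hq0 : 0 < q) (hq1 : q < 1) {R : ℝ} {s : Fin r → ℂ}
    (hs : ∀ i, ‖s i‖ ≤ R) (k : Index r) :
    ‖term q s k‖ ≤ ((1 / (1 - q)) ^ R) ^ r * ‖(q : ℂ) ^ pairing s k‖ := by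
  have h1 : ∀ i, ‖((qNumber q (k.1 i) : ℝ) : ℂ) ^ s i‖⁻¹ ≤ (1 / (1 - q)) ^ R := by
    intro i
    have h := one_le_qNumber hq0 hq1 (k.2.2 i)
    have h0 : 0 < qNumber q (k.1 i) := by linarith
    have hR : 0 ≤ R := (norm_nonneg _).trans (hs i)
    rw [Complex.norm_cpow_eq_rpow_re_of_pos h0, ← Real.rpow_neg h0.le]
    calc qNumber q (k.1 i) ^ (-(s i).re) ≤ qNumber q (k.1 i) ^ R :=
          Real.rpow_le_rpow_of_exponent_le h
            ((neg_le_abs _).trans ((Complex.abs_re_le_norm _).trans (hs i)))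
      _ ≤ _ := Real.rpow_le_rpow h0.le (qNumber_le hq0 hq1 _) hR
  rw [term, norm_div, norm_prod, div_eq_mul_inv, mul_comm, ← Finset.prod_inv_distrib]
  refine mul_le_mul_of_nonneg_right ?_ (norm_nonneg _)
  refine (Finset.prod_le_prod (fun i _ => by positivity) fun i _ => h1 i).trans ?_
  simp

theorem term_add_single {q : ℝ} (hq0 : 0 < q) (hq1 : q < 1) (s : Fin (r + 1) → ℂ) (c : ℂ)
    (k : Index (r + 1)) :
    term q (fun i => s i + if i = 0 then c else 0) k =
      term q s k * ((q : ℂ) ^ ((k.1 0 : ℂ) * c) / ((qNumber q (k.1 0) : ℝ) : ℂ) ^ c) := by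
  have hq : (q : ℂ) ≠ 0 := by exact_mod_cast hq0.ne'
  have hk : ∀ i, ((qNumber q (k.1 i) : ℝ) : ℂ) ≠ 0 := fun i => by
    exact_mod_cast (zero_lt_one.trans_le (one_le_qNumber hq0 hq1 (k.2.2 i))).ne'
  simp only [term, mul_add, Finset.sum_add_distrib, Complex.cpow_add _ _ hq,
    Complex.cpow_add _ _ (hk _), Finset.prod_mul_distrib]
  have e : ∏ i, ((qNumber q (k.1 i) : ℝ) : ℂ) ^ (if i = 0 then c else 0) =
      ((qNumber q (k.1 0) : ℝ) : ℂ) ^ c := by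
    rw [Finset.prod_eq_single 0]
    · simp
    · intro i _ hi
      simp [hi]
    · simp
  rw [e]
  simp only [mul_ite, mul_zero, Finset.sum_ite_eq', Finset.mem_univ, if_true]
  rw [mul_div_mul_comm]

theorem term_add_natCast {q : ℝ} (hq0 : 0 < q) (hq1 : q < 1) (s : Fin (r + 1) → ℂ) (n : ℕ)
    (k : Index (r + 1)) :
    term q (fun i => s i + if i = 0 then (n : ℂ) else 0) k =
      term q s k * ((q ^ k.1 0 / qNumber q (k.1 0) : ℝ) : ℂ) ^ n := by
  rw [term_add_single hq0 hq1, ← Nat.cast_mul, Complex.cpow_natCast, Complex.cpow_natCast, pow_mul,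
    ← div_pow]
  push_cast
  rfl

theorem norm_term_add_natCast_le {q : ℝ} (hq0 : 0 < q) (hq1 : q < 1) (s : Fin (r + 1) → ℂ)
    (n : ℕ) (k : Index (r + 1)) :
    ‖term q (fun i => s i + if i = 0 then (n : ℂ) else 0) k‖ ≤ ‖term q s k‖ * q ^ n := by
  rw [term_add_natCast hq0 hq1, norm_mul, norm_pow, Complex.norm_real,
    Real.norm_of_nonneg (pow_div_qNumber_nonneg hq0 hq1 (k.2.2 0))]
  gcongr
  · exact pow_div_qNumber_nonneg hq0 hq1 (k.2.2 0)
  · exact pow_div_qNumber_le hq0 hq1 (k.2.2 0)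

/-- On compact subsets of the region the defining series has a summable majorant. -/
theorem exists_majorant {q : ℝ} (hq0 : 0 < q) (hq1 : q < 1) {K : Set (Fin (r + 1) → ℂ)}
    (hK : IsCompact K) (hKr : K ⊆ region (r + 1)) :
    ∃ M : Index (r + 1) → ℝ, Summable M ∧ ∀ k, ∀ s ∈ K, ‖term q s k‖ ≤ M k := by
  obtain ⟨R, hR⟩ := hK.isBounded.exists_norm_le
  have hne : (Finset.univ : Finset (Fin (r + 1))).Nonempty := Finset.univ_nonempty
  have hcont : Continuous fun s : Fin (r + 1) → ℂ =>
      Finset.univ.inf' hne fun j => (∑ i ∈ Finset.Iic j, s i).re :=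
    Continuous.finset_inf'_apply hne fun j _ => by fun_prop
  obtain ⟨ε, hε, hεK⟩ := hK.exists_forall_le' hcont.continuousOn (a := 0)
    (fun s hs => (Finset.lt_inf'_iff hne).2 fun j _ => hKr hs j)
  -- The comparison point (ε, 0, …, 0) has all partial sums equal to ε, the lower bound for the real
  -- parts of the partial sums on K.
  let y : Fin (r + 1) → ℂ := fun i => if i = 0 then (ε : ℂ) else 0
  have hy : ∀ j, (∑ i ∈ Finset.Iic j, y i).re = ε := by
    intro j
    simp [y]
  have hyr : y ∈ region (r + 1) := fun j => by rw [hy j]; exact hε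
  refine ⟨fun k => ((1 / (1 - q)) ^ R) ^ (r + 1) * ‖(q : ℂ) ^ pairing y k‖,
    ((hasSum_qpow_pairing hq0 hq1 hyr).summable.norm).mul_left _, fun k s hs => ?_⟩
  refine (norm_term_le hq0 hq1 (fun i => (norm_le_pi_norm s i).trans (hR s hs)) k).trans ?_
  have h1 : 0 ≤ 1 / (1 - q) := by
    have : 0 < 1 - q := by linarith
    positivity
  refine mul_le_mul_of_nonneg_left ?_ (pow_nonneg (Real.rpow_nonneg h1 R) _)
  rw [norm_qpow hq0, norm_qpow hq0]
  refine Real.rpow_le_rpow_of_exponent_ge hq0 hq1.le (pairing_re_mono (fun j => ?_) k)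
  rw [hy j]
  exact (hεK s hs).trans (Finset.inf'_le _ (Finset.mem_univ j))

theorem summable_norm_term {q : ℝ} (hq0 : 0 < q) (hq1 : q < 1) {s : Fin (r + 1) → ℂ}
    (hs : s ∈ region (r + 1)) : Summable fun k => ‖term q s k‖ := by
  obtain ⟨M, hM, hb⟩ := exists_majorant hq0 hq1 isCompact_singleton (Set.singleton_subset_iff.2 hs)
  exact Summable.of_nonneg_of_le (fun k => norm_nonneg _) (fun k => hb k s rfl) hM

theorem holomorphicAt_of_hasSum_term {q : ℝ} (hq0 : 0 < q) (hq1 : q < 1)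
    {Z : (Fin (r + 1) → ℂ) → ℂ} (hZ : ∀ s ∈ region (r + 1), HasSum (term q s) (Z s))
    {p : Fin (r + 1) → ℂ} (hp : p ∈ region (r + 1)) : HolomorphicAt Z p := by
  obtain ⟨ρ, hρ, hsub⟩ := Metric.nhds_basis_closedBall.mem_iff.1
    ((isOpen_region (r + 1)).mem_nhds hp)
  obtain ⟨M, hM, hb⟩ := exists_majorant hq0 hq1 (isCompact_closedBall p ρ) hsub
  have hd := differentiableOn_tsum_ball hM hρ (f := fun k s => term q s k)
    (fun k => (differentiable_term hq0 hq1 k).differentiableOn)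
    (fun k z hz => hb k z (Metric.ball_subset_closedBall hz))
  have hol : HolomorphicAt (fun s => ∑' k, term q s k) p := by
    filter_upwards [Metric.ball_mem_nhds p (half_pos hρ)] with z hz
    exact hd.differentiableAt (Metric.isOpen_ball.mem_nhds hz)
  refine hol.congr ?_
  filter_upwards [(isOpen_region (r + 1)).mem_nhds hp] with z hz using (hZ z hz).tsum_eq

/-- Bounds for the values of `ζ_q` under translation of the first variable. -/
theorem exists_norm_le_mul_pow {q : ℝ} (hq0 : 0 < q) (hq1 : q < 1) {Z : (Fin (r + 1) → ℂ) → ℂ}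
    (hZ : ∀ s ∈ region (r + 1), HasSum (term q s) (Z s)) {K : Set (Fin (r + 1) → ℂ)}
    (hK : IsCompact K) (hKr : K ⊆ region (r + 1)) :
    ∃ A : ℝ, ∀ s ∈ K, ∀ n : ℕ, ‖Z fun i => s i + if i = 0 then (n : ℂ) else 0‖ ≤ A * q ^ n := by
  obtain ⟨M, hM, hb⟩ := exists_majorant hq0 hq1 hK hKr
  refine ⟨∑' k, M k, fun s hs n => ?_⟩
  have hreg : (fun i => s i + if i = 0 then (n : ℂ) else 0) ∈ region (r + 1) := by
    intro j
    have := hKr hs j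
    rw [Finset.sum_add_distrib]
    simp only [Finset.sum_ite_eq', Finset.mem_Iic, Fin.zero_le, if_true, Complex.add_re,
      Complex.natCast_re]
    positivity
  rw [← (hZ _ hreg).tsum_eq]
  refine tsum_of_norm_bounded (hM.hasSum.mul_right (q ^ n)) fun k => ?_
  refine (norm_term_add_natCast_le hq0 hq1 s n k).trans ?_
  gcongr
  exact hb k s hs

/-- A series with binomial coefficients and translated values of `ζ_q` converges normally. -/
theorem normallySummableOn_of_coef {q : ℝ} (hq0 : 0 < q) (hq1 : q < 1)
    {Z : (Fin (r + 1) → ℂ) → ℂ} (hZ : ∀ s ∈ region (r + 1), HasSum (term q s) (Z s))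
    {m : ℕ} {K : Set (Fin (m + 1) → ℂ)} (hK : IsCompact K)
    {β : (Fin (m + 1) → ℂ) → (Fin (r + 1) → ℂ)} (hβ : Continuous β)
    (hβK : ∀ s ∈ K, β s ∈ region (r + 1)) (l : ℕ) {F : ℕ → (Fin (m + 1) → ℂ) → ℂ}
    (hF : ∀ n, ∀ s ∈ K, ‖F n s‖ ≤
      ‖coef (s 0) (n + l)‖ * ‖Z fun i => β s i + if i = 0 then (n : ℂ) else 0‖) :
    NormallySummableOn F K := by
  obtain ⟨R, hR⟩ := hK.isBounded.exists_norm_le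
  obtain ⟨A, hA⟩ := exists_norm_le_mul_pow hq0 hq1 hZ (hK.image hβ)
    (Set.image_subset_iff.2 hβK)
  -- The factor q^n is written as q^(n+l)/q^l so that the majorant is a tail of the binomial series
  -- at q.
  refine ⟨fun n => ‖coef R (n + l)‖ * q ^ (n + l) * (A * (q ^ l)⁻¹), ?_, fun n s hs => ?_⟩
  · exact ((summable_nat_add_iff l).2 (summable_norm_coef_mul_pow R hq0.le hq1)).mul_right _
  · refine (hF n s hs).trans ?_
    have h1 := norm_coef_le ((norm_le_pi_norm s 0).trans (hR s hs)) (n + l)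
    have h2 := hA _ (Set.mem_image_of_mem β hs) n
    calc _ ≤ ‖coef R (n + l)‖ * (A * q ^ n) :=
          mul_le_mul h1 h2 (norm_nonneg _) (norm_nonneg _)
      _ = _ := by
        simp only [pow_add]
        field_simp

end Term

/-! ### The binomial expansion that defines the continuation. -/

section Expansion

variable {r : ℕ}

/-- The sum `q^w / (1 - q^w)` of the geometric series `∑_{m ≥ 1} q^(m w)`. -/
def geo (q : ℝ) (w : ℂ) : ℂ := (q : ℂ) ^ w / (1 - (q : ℂ) ^ w)

/-- The terms of the series obtained by expanding every factor `(1 - q^k)^(-s)` binomially. -/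
def expansionTerm (q : ℝ) (n : Fin r → ℕ) (s : Fin r → ℂ) : ℂ :=
  (∏ i, coef (s i) (n i)) *
    ∏ j, geo q (∑ i ∈ Finset.Iic j, s i + (∑ i ∈ Finset.Iic j, n i : ℕ))

/-- The expansion that continues `ζ_q` to a meromorphic function. -/
def continuation (q : ℝ) (s : Fin r → ℂ) : ℂ :=
  ((1 - q : ℝ) : ℂ) ^ (∑ i, s i) * ∑' n, expansionTerm q n s

theorem cpow_sum {ι : Type*} (u : Finset ι) (f : ι → ℂ) {x : ℂ} (hx : x ≠ 0) :
    x ^ (∑ i ∈ u, f i) = ∏ i ∈ u, x ^ f i := by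
  classical
  induction u using Finset.induction_on with
  | empty => simp
  | insert i u hi ih => rw [Finset.sum_insert hi, Finset.prod_insert hi,
    Complex.cpow_add _ _ hx, ih]

theorem hasSum_pairing_expansion {q : ℝ} (hq0 : 0 < q) (hq1 : q < 1) (s : Fin r → ℂ)
    (k : Index r) :
    HasSum (fun n : Fin r → ℕ => (q : ℂ) ^ pairing s k * ∏ i, coef (s i) (n i) *
      ((q ^ k.1 i : ℝ) : ℂ) ^ n i)
      ((q : ℂ) ^ pairing s k * ∏ i, ((1 - q ^ k.1 i : ℝ) : ℂ) ^ (-s i)) := by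
  refine HasSum.mul_left _
    (hasSum_pi_prod (f := fun i m => coef (s i) m * ((q ^ k.1 i : ℝ) : ℂ) ^ m) fun i => ?_)
  have h1 : ‖((q ^ k.1 i : ℝ) : ℂ)‖ < 1 := by
    rw [Complex.norm_real, Real.norm_of_nonneg (by positivity)]
    exact pow_lt_one₀ hq0.le hq1 (Nat.one_le_iff_ne_zero.1 (k.2.2 i))
  simpa using hasSum_coef (s i) h1

theorem term_eq_mul_pairing {q : ℝ} (hq0 : 0 < q) (hq1 : q < 1) (s : Fin r → ℂ) (k : Index r) :
    term q s k = ((1 - q : ℝ) : ℂ) ^ (∑ i, s i) *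
      ((q : ℂ) ^ pairing s k * ∏ i, ((1 - q ^ k.1 i : ℝ) : ℂ) ^ (-s i)) := by
  have h1 : 0 < 1 - q := by linarith
  have h1' : ((1 - q : ℝ) : ℂ) ≠ 0 := by exact_mod_cast h1.ne'
  have hk : ∀ i, 0 < 1 - q ^ k.1 i := fun i => by
    have := pow_lt_one₀ hq0.le hq1 (Nat.one_le_iff_ne_zero.1 (k.2.2 i))
    linarith
  have e : ∀ i, ((qNumber q (k.1 i) : ℝ) : ℂ) ^ s i =
      (((1 - q ^ k.1 i : ℝ) : ℂ) ^ (-s i))⁻¹ * (((1 - q : ℝ) : ℂ) ^ s i)⁻¹ := by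
    intro i
    rw [qNumber, div_eq_mul_inv, Complex.ofReal_mul,
      Complex.mul_cpow_ofReal_nonneg (hk i).le (inv_nonneg.2 h1.le), Complex.cpow_neg, inv_inv,
      Complex.ofReal_inv, Complex.inv_cpow _ _ (by
        rw [Complex.arg_ofReal_of_nonneg h1.le]; exact Real.pi_pos.ne)]
  rw [term, Finset.prod_congr rfl fun i _ => e i, Finset.prod_mul_distrib, Finset.prod_inv_distrib,
    Finset.prod_inv_distrib, cpow_sum _ _ h1']
  rw [pairing]
  simp only [div_eq_mul_inv, mul_inv, inv_inv]
  ring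

theorem hasSum_term_continuation {q : ℝ} (hq0 : 0 < q) (hq1 : q < 1) {s : Fin (r + 1) → ℂ}
    (hs : s ∈ region (r + 1)) : HasSum (term q s) (continuation q s) := by
  have hq : (q : ℂ) ≠ 0 := by exact_mod_cast hq0.ne'
  let F : Index (r + 1) × (Fin (r + 1) → ℕ) → ℂ := fun p =>
    (q : ℂ) ^ pairing s p.1 * ∏ i, coef (s i) (p.2 i) * ((q ^ p.1.1 i : ℝ) : ℂ) ^ p.2 i
  -- Since k_i ≥ 1, each q^(k_i) is at most q. The double family is thus dominated by a product of
  -- two summable families, which permits exchanging the sums.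
  have hsum : Summable F := by
    have h1 := (hasSum_mul_complex (hasSum_qpow_pairing hq0 hq1 hs)
      (hasSum_pi_prod fun i => hasSum_coef (s i) (x := (q : ℂ))
        (by simpa [abs_of_pos hq0] using hq1))).summable.norm
    refine h1.of_norm_bounded fun p => ?_
    simp only [F, norm_mul, norm_prod, norm_pow, Complex.norm_real, Real.norm_of_nonneg hq0.le]
    gcongr with i
    calc q ^ p.1.1 i ≤ q ^ 1 := pow_le_pow_of_le_one hq0.le hq1.le (p.1.2.2 i)
      _ = q := pow_one q
  have hk := hsum.hasSum.prod_fiberwise fun k => hasSum_pairing_expansion hq0 hq1 s k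
  have hn : HasSum (fun n => expansionTerm q n s) (∑' p, F p) := by
    have hswap := (Equiv.prodComm (Fin (r + 1) → ℕ) (Index (r + 1))).hasSum_iff.2 hsum.hasSum
    refine hswap.prod_fiberwise fun n => ?_
    -- For fixed n, the powers of q shift s by n, so the sum over k is again a geometric sum over
    -- the indices.
    have hreg : (fun i => s i + (n i : ℂ)) ∈ region (r + 1) := by
      intro j
      have := hs j
      rw [Finset.sum_add_distrib, Complex.add_re, ← Nat.cast_sum, Complex.natCast_re]
      positivity
    have h := (hasSum_qpow_pairing hq0 hq1 hreg).mul_left (∏ i, coef (s i) (n i))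
    have e : ∀ k : Index (r + 1), (F ∘ Equiv.prodComm (Fin (r + 1) → ℕ) (Index (r + 1))) (n, k) =
        (∏ i, coef (s i) (n i)) * (q : ℂ) ^ pairing (fun i => s i + (n i : ℂ)) k := by
      intro k
      have : (q : ℂ) ^ pairing (fun i => s i + (n i : ℂ)) k =
          (q : ℂ) ^ pairing s k * ∏ i, ((q ^ k.1 i : ℝ) : ℂ) ^ n i := by
        simp only [pairing, mul_add, Finset.sum_add_distrib, Complex.cpow_add _ _ hq]
        congr 1
        rw [cpow_sum _ _ hq]
        refine Finset.prod_congr rfl fun i _ => ?_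
        rw [← Nat.cast_mul, Complex.cpow_natCast, pow_mul]
        push_cast
        rfl
      rw [this]
      simp only [F, Function.comp, Equiv.prodComm_apply, Prod.swap, Finset.prod_mul_distrib]
      ring
    simp only [e, expansionTerm, geo]
    simpa only [Finset.sum_add_distrib, Nat.cast_sum] using h
  rw [continuation, hn.tsum_eq]
  rw [show term q s = _ from funext (term_eq_mul_pairing hq0 hq1 s)]
  exact hk.mul_left _

end Expansion

/-! ### Clearing denominators and meromorphy of the expansion. -/

section Continuation

/-- The product of the first `M` denominators. -/
def denom (q : ℝ) (M : ℕ) (w : ℂ) : ℂ := ∏ m ∈ Finset.range M, (1 - (q : ℂ) ^ (w + m))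

/-- The product of `geo q (w + m)` and `denom q M w`, with removable singularities filled in. -/
def regGeo (q : ℝ) (M m : ℕ) (w : ℂ) : ℂ :=
  (q : ℂ) ^ (w + m) * (if m < M then 1 else (1 - (q : ℂ) ^ (w + m))⁻¹) *
    ∏ l ∈ (Finset.range M).erase m, (1 - (q : ℂ) ^ (w + l))

theorem regGeo_eq {q : ℝ} {M : ℕ} {w : ℂ} (h : denom q M w ≠ 0) (m : ℕ) :
    regGeo q M m w = geo q (w + m) * denom q M w := by
  by_cases hm : m < M
  · have hmem : m ∈ Finset.range M := Finset.mem_range.2 hm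
    have h0 := Finset.prod_ne_zero_iff.1 h m hmem
    rw [denom, ← Finset.mul_prod_erase _ _ hmem, regGeo, geo, if_pos hm]
    field_simp
  · rw [regGeo, geo, if_neg hm, denom, Finset.erase_eq_of_notMem (by simpa using hm)]
    ring

theorem differentiable_one_sub_qpow {q : ℝ} (hq0 : 0 < q) (m : ℕ) :
    Differentiable ℂ fun w : ℂ => 1 - (q : ℂ) ^ (w + m) := by
  have hq : (q : ℂ) ≠ 0 := by exact_mod_cast hq0.ne'
  have : Differentiable ℂ fun w : ℂ => w + (m : ℂ) := by fun_prop
  exact (this.const_cpow (Or.inl hq)).const_sub 1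

theorem norm_qpow_add_le {q ρ : ℝ} (hq0 : 0 < q) (hq1 : q < 1) {w : ℂ} (hw : ‖w‖ ≤ ρ) (m : ℕ) :
    ‖(q : ℂ) ^ (w + m)‖ ≤ q ^ (-ρ) * q ^ m := by
  rw [norm_qpow hq0, Complex.add_re, Complex.natCast_re, Real.rpow_add hq0, Real.rpow_natCast]
  refine mul_le_mul_of_nonneg_right
    (Real.rpow_le_rpow_of_exponent_ge hq0 hq1.le ?_) (by positivity)
  have := (abs_le.1 (Complex.abs_re_le_norm w)).1
  linarith

theorem norm_qpow_add_le_of_le {q ρ : ℝ} (hq0 : 0 < q) (hq1 : q < 1) {w : ℂ} (hw : ‖w‖ ≤ ρ)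
    {m : ℕ} (hm : ρ + 1 ≤ m) : ‖(q : ℂ) ^ (w + m)‖ ≤ q := by
  rw [norm_qpow hq0, Complex.add_re, Complex.natCast_re]
  have := (abs_le.1 (Complex.abs_re_le_norm w)).1
  calc q ^ (w.re + m) ≤ q ^ (1 : ℝ) :=
        Real.rpow_le_rpow_of_exponent_ge hq0 hq1.le (by linarith)
    _ = q := Real.rpow_one q

theorem one_sub_qpow_ne_zero {q : ℝ} (hq0 : 0 < q) (hq1 : q < 1) {w : ℂ}
    (hw : 0 < w.re) : 1 - (q : ℂ) ^ w ≠ 0 := by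
  intro h
  have := norm_qpow_lt_one hq0 hq1 hw
  rw [← sub_eq_zero.1 h] at this
  simp at this

theorem differentiableAt_regGeo {q ρ : ℝ} (hq0 : 0 < q) (hq1 : q < 1) {M : ℕ} (hM : ρ + 1 ≤ M)
    (m : ℕ) {w : ℂ} (hw : ‖w‖ ≤ ρ) : DifferentiableAt ℂ (regGeo q M m) w := by
  have hq : (q : ℂ) ≠ 0 := by exact_mod_cast hq0.ne'
  have h1 : Differentiable ℂ fun w : ℂ => (q : ℂ) ^ (w + m) := by
    have : Differentiable ℂ fun w : ℂ => w + (m : ℂ) := by fun_prop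
    exact this.const_cpow (Or.inl hq)
  have h3 : DifferentiableAt ℂ
      (fun w : ℂ => ∏ l ∈ (Finset.range M).erase m, (1 - (q : ℂ) ^ (w + l))) w :=
    DifferentiableAt.fun_finsetProd fun l _ => differentiable_one_sub_qpow hq0 l w
  unfold regGeo
  refine DifferentiableAt.fun_mul (DifferentiableAt.fun_mul (h1 w) ?_) h3
  by_cases hm : m < M
  · simp [hm]
  · simp only [hm, if_false]
    refine DifferentiableAt.fun_inv (differentiable_one_sub_qpow hq0 m w) ?_
    refine one_sub_qpow_ne_zero hq0 hq1 ?_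
    have := (abs_le.1 (Complex.abs_re_le_norm w)).1
    have h4 : (M : ℝ) ≤ m := by exact_mod_cast not_lt.1 hm
    rw [Complex.add_re, Complex.natCast_re]
    linarith

/-- For m ≥ M the bound ρ + 1 ≤ M gives |q^(w+m)| ≤ q, so the remaining inverse is at most 1/(1-q).
The other factors number at most M and are bounded; the decay q^m comes from the numerator. -/
theorem exists_norm_regGeo_le {q ρ : ℝ} (hq0 : 0 < q) (hq1 : q < 1) {M : ℕ} (hM : ρ + 1 ≤ M) :
    ∃ C : ℝ, 0 ≤ C ∧ ∀ m w, ‖w‖ ≤ ρ → ‖regGeo q M m w‖ ≤ C * q ^ m := by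
  have h1q : 0 < 1 - q := by linarith
  have hqρ : 0 < q ^ (-ρ) := Real.rpow_pos_of_pos hq0 _
  refine ⟨q ^ (-ρ) * (1 - q)⁻¹ * (1 + q ^ (-ρ)) ^ M, by positivity, fun m w hw => ?_⟩
  have h2 : ‖if m < M then (1 : ℂ) else (1 - (q : ℂ) ^ (w + m))⁻¹‖ ≤ (1 - q)⁻¹ := by
    split_ifs with hm
    · rw [norm_one]
      exact (one_le_inv₀ h1q).2 (by linarith)
    · rw [norm_inv]
      refine inv_anti₀ h1q ?_
      have h4 : (M : ℝ) ≤ m := by exact_mod_cast not_lt.1 hm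
      have h5 := norm_qpow_add_le_of_le hq0 hq1 hw (hM.trans h4)
      have h6 := norm_sub_norm_le (1 : ℂ) ((q : ℂ) ^ (w + m))
      rw [norm_one] at h6
      linarith
  have h3 : ‖∏ l ∈ (Finset.range M).erase m, (1 - (q : ℂ) ^ (w + l))‖ ≤ (1 + q ^ (-ρ)) ^ M := by
    rw [norm_prod]
    calc _ ≤ ∏ l ∈ (Finset.range M).erase m, (1 + q ^ (-ρ)) := by
          refine Finset.prod_le_prod (fun _ _ => norm_nonneg _) fun l _ => ?_
          refine (norm_sub_le _ _).trans ?_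
          rw [norm_one]
          gcongr
          refine (norm_qpow_add_le hq0 hq1 hw l).trans ?_
          exact mul_le_of_le_one_right hqρ.le (pow_le_one₀ hq0.le hq1.le)
      _ ≤ _ := by
          rw [Finset.prod_const]
          refine pow_le_pow_right₀ (by linarith) ?_
          exact (Finset.card_le_card (Finset.erase_subset _ _)).trans (by simp)
  rw [regGeo, norm_mul, norm_mul]
  calc _ ≤ q ^ (-ρ) * q ^ m * (1 - q)⁻¹ * (1 + q ^ (-ρ)) ^ M := by
        gcongr
        exact norm_qpow_add_le hq0 hq1 hw m
    _ = _ := by ring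

variable {r : ℕ}

/-- The denominators of all partial sums of the arguments. -/
def totalDenom (q : ℝ) (M : ℕ) (s : Fin r → ℂ) : ℂ :=
  ∏ j, denom q M (∑ i ∈ Finset.Iic j, s i)

theorem differentiable_totalDenom {q : ℝ} (hq0 : 0 < q) (M : ℕ) :
    Differentiable ℂ (totalDenom (r := r) q M) := by
  have h1 : Differentiable ℂ (denom q M) := fun w =>
    DifferentiableAt.fun_finsetProd fun l _ => differentiable_one_sub_qpow hq0 l w
  refine differentiableOn_univ.1 (differentiableOn_prod fun j _ =>
    Differentiable.differentiableOn ?_)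
  exact h1.comp (by fun_prop)

/-- The function is entire and nonzero on the region, so it cannot vanish near any point. -/
theorem frequently_totalDenom_ne_zero {q : ℝ} (hq0 : 0 < q) (hq1 : q < 1) (M : ℕ)
    (p : Fin r → ℂ) : ∃ᶠ z in 𝓝 p, totalDenom q M z ≠ 0 := by
  intro h
  obtain ⟨s, hs⟩ := nonempty_region r
  have h0 := eqOn_zero_of_convex isOpen_univ convex_univ
    (differentiable_totalDenom hq0 M).differentiableOn (Set.mem_univ p) (by simpa using h)
    s (Set.mem_univ s)
  refine Finset.prod_ne_zero_iff.2 (fun j _ => ?_) h0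
  refine Finset.prod_ne_zero_iff.2 (fun m _ => one_sub_qpow_ne_zero hq0 hq1 ?_)
  have := hs j
  rw [Complex.add_re, Complex.natCast_re]
  positivity

/-- Near p one finite product of denominators clears every term of the expansion, because only
shifts m < M can give poles there. The cleared series converges normally and is the numerator. -/
theorem meromorphic_continuation {q : ℝ} (hq0 : 0 < q) (hq1 : q < 1) :
    Meromorphic (continuation (r := r) q) := by
  intro p
  set R : ℝ := ‖p‖ + 1
  have hR : ∀ z ∈ Metric.ball p 1, ‖z‖ ≤ R := fun z hz => by
    have h1 := norm_le_norm_add_norm_sub' z p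
    rw [Metric.mem_ball, dist_eq_norm] at hz
    linarith
  have hRi : ∀ z ∈ Metric.ball p 1, ∀ i, ‖z i‖ ≤ R := fun z hz i =>
    (norm_le_pi_norm z i).trans (hR z hz)
  set ρ : ℝ := r * R
  have hρ : ∀ z ∈ Metric.ball p 1, ∀ j, ‖∑ i ∈ Finset.Iic j, z i‖ ≤ ρ :=
    fun z hz j => norm_sum_Iic_le (by positivity) (hRi z hz) j
  obtain ⟨M, hM⟩ := exists_nat_ge (ρ + 1)
  obtain ⟨C, hC0, hC⟩ := exists_norm_regGeo_le hq0 hq1 hM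
  let G : (Fin r → ℕ) → (Fin r → ℂ) → ℂ := fun n z => (∏ i, coef (z i) (n i)) *
    ∏ j, regGeo q M (∑ i ∈ Finset.Iic j, n i) (∑ i ∈ Finset.Iic j, z i)
  have hGd : ∀ n, DifferentiableOn ℂ (G n) (Metric.ball p 1) := by
    intro n
    refine DifferentiableOn.fun_mul (differentiableOn_prod fun i _ => ?_)
      (differentiableOn_prod fun j _ => ?_)
    · exact ((differentiable_coef (n i)).comp (differentiable_apply i)).differentiableOn
    · intro z hz
      have hl : Differentiable ℂ fun z : Fin r → ℂ => ∑ i ∈ Finset.Iic j, z i := by fun_prop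
      exact (DifferentiableAt.comp z (differentiableAt_regGeo hq0 hq1 hM _ (hρ z hz j))
        (hl z)).differentiableWithinAt
  have hGb : ∀ n, ∀ z ∈ Metric.ball p 1,
      ‖G n z‖ ≤ ‖∏ i, coef (R : ℂ) (n i) * (q : ℂ) ^ n i * C‖ := by
    intro n z hz
    simp only [G, norm_mul, norm_prod, norm_pow, Complex.norm_real, Real.norm_of_nonneg hq0.le,
      Real.norm_of_nonneg hC0]
    rw [← Finset.prod_mul_distrib]
    refine Finset.prod_le_prod (fun i _ => by positivity) fun i _ => ?_
    rw [mul_assoc]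
    refine mul_le_mul (norm_coef_le (hRi z hz i) _) ?_ (norm_nonneg _) (norm_nonneg _)
    refine (hC _ _ (hρ z hz i)).trans ?_
    rw [mul_comm]
    -- Of the decay q^(n_1+⋯+n_j) only q^(n_j) is kept, so that the majorant factors over the
    -- coordinates.
    gcongr ?_ * C
    exact pow_le_pow_of_le_one hq0.le hq1.le
      (Finset.single_le_sum (fun _ _ => Nat.zero_le _) (Finset.mem_Iic.2 le_rfl))
  have hsum : Summable fun n : Fin r → ℕ => ‖∏ i, coef (R : ℂ) (n i) * (q : ℂ) ^ n i * C‖ :=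
    (hasSum_pi_prod fun _ => (hasSum_coef (R : ℂ) (x := (q : ℂ))
      (by simpa [abs_of_pos hq0] using hq1)).mul_right (C : ℂ)).summable.norm
  have hd := differentiableOn_tsum_ball hsum one_pos hGd hGb
  have h1q : ((1 - q : ℝ) : ℂ) ≠ 0 := by
    have : 1 - q ≠ 0 := by linarith
    exact_mod_cast this
  have hpre : Differentiable ℂ fun z : Fin r → ℂ => ((1 - q : ℝ) : ℂ) ^ (∑ i, z i) := by
    have : Differentiable ℂ fun z : Fin r → ℂ => ∑ i, z i := by fun_prop
    exact this.const_cpow (Or.inl h1q)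
  refine ⟨fun z => ((1 - q : ℝ) : ℂ) ^ (∑ i, z i) * ∑' n, G n z, totalDenom q M,
    HolomorphicAt.mul hpre.holomorphicAt ?_, (differentiable_totalDenom hq0 M).holomorphicAt,
    frequently_totalDenom_ne_zero hq0 hq1 M p, Eventually.of_forall fun z hz => ?_⟩
  · filter_upwards [Metric.ball_mem_nhds p (half_pos one_pos)] with z hz
    exact hd.differentiableAt (Metric.isOpen_ball.mem_nhds hz)
  · have hG : ∀ n, G n z = expansionTerm q n z * totalDenom q M z := by
      intro n
      have h0 := Finset.prod_ne_zero_iff.1 hz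
      simp only [G, expansionTerm, totalDenom, mul_assoc, ← Finset.prod_mul_distrib]
      exact Finset.prod_congr rfl fun j hj => by rw [regGeo_eq (h0 j hj)]
    simp only [hG, tsum_mul_right, continuation]
    field_simp

theorem isMeromorphicContinuation_continuation {q : ℝ} (hq0 : 0 < q) (hq1 : q < 1) (r : ℕ) :
    IsMeromorphicContinuation q (r + 1) (continuation q) :=
  ⟨meromorphic_continuation hq0 hq1, fun _ hs => hasSum_term_continuation hq0 hq1 hs⟩

end Continuation

/-! ### The translation formula on the region of convergence. -/

section Translation

variable {r : ℕ}

/-- The ratio `q^(k_1) / [k_1]`. -/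
def ratio (q : ℝ) (k : Index (r + 1)) : ℝ := q ^ k.1 0 / qNumber q (k.1 0)

/-- Binomial summation in the first variable: both series have the same sum. -/
theorem exists_hasSum_binomial {q : ℝ} (hq0 : 0 < q) (hq1 : q < 1) {Z : (Fin (r + 1) → ℂ) → ℂ}
    (hZ : ∀ s ∈ region (r + 1), HasSum (term q s) (Z s)) {t : Fin (r + 1) → ℂ}
    (ht : t ∈ region (r + 1)) (a : ℂ) :
    ∃ S : ℂ, HasSum (fun n : ℕ => (-1) ^ n * coef a n *
        Z fun i => t i + if i = 0 then (n : ℂ) else 0) S ∧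
      HasSum (fun k : Index (r + 1) => ((1 + ratio q k : ℝ) : ℂ) ^ (-a) * term q t k) S := by
  have hx0 : ∀ k : Index (r + 1), 0 ≤ ratio q k := fun k =>
    pow_div_qNumber_nonneg hq0 hq1 (k.2.2 0)
  have hxq : ∀ k : Index (r + 1), ratio q k ≤ q := fun k => pow_div_qNumber_le hq0 hq1 (k.2.2 0)
  let F : ℕ × Index (r + 1) → ℂ := fun p => coef a p.1 * (-ratio q p.2 : ℂ) ^ p.1 * term q t p.2
  have hsum : Summable F := by
    have h1 := summable_norm_coef_mul_pow a hq0.le hq1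
    have h2 := Summable.mul_of_nonneg h1 (summable_norm_term hq0 hq1 ht)
      (fun n => by positivity) (fun k => norm_nonneg _)
    refine h2.of_norm_bounded fun p => ?_
    simp only [F, norm_mul, norm_pow, norm_neg, Complex.norm_real, Real.norm_of_nonneg (hx0 p.2)]
    gcongr
    · exact hx0 p.2
    · exact hxq p.2
  -- One double sum in two orders: over k first it gives translated values of Z, over n first the
  -- binomial series at -`ratio q k`.
  refine ⟨∑' p, F p, hsum.hasSum.prod_fiberwise fun n => ?_,
    ((Equiv.prodComm (Index (r + 1)) ℕ).hasSum_iff.2 hsum.hasSum).prod_fiberwise fun k => ?_⟩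
  · have hreg : (fun i => t i + if i = 0 then (n : ℂ) else 0) ∈ region (r + 1) := by
      intro j
      have := ht j
      rw [Finset.sum_add_distrib]
      simp only [Finset.sum_ite_eq', Finset.mem_Iic, Fin.zero_le, if_true, Complex.add_re,
        Complex.natCast_re]
      positivity
    have h := (hZ _ hreg).mul_left ((-1) ^ n * coef a n)
    have e : ∀ k, F (n, k) = (-1) ^ n * coef a n *
        term q (fun i => t i + if i = 0 then (n : ℂ) else 0) k := by
      intro k
      rw [term_add_natCast hq0 hq1]
      simp only [F, ratio, neg_pow ((_ : ℝ) : ℂ)]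
      ring
    simpa only [e] using h
  · have hlt : ‖-(ratio q k : ℂ)‖ < 1 := by
      rw [norm_neg, Complex.norm_real, Real.norm_of_nonneg (hx0 k)]
      exact (hxq k).trans_lt hq1
    have h := (hasSum_coef a hlt).mul_right (term q t k)
    simpa [F, Function.comp_def] using h

/-- Rests on [k+1] = [k] + q^k = [k](1 + q^k/[k]); the bases are positive reals, so complex powers
are multiplicative. -/
theorem cpow_qNumber_succ {q : ℝ} (hq0 : 0 < q) (hq1 : q < 1) {k : ℕ} (hk : 1 ≤ k) (a : ℂ) :
    ((1 + q ^ k / qNumber q k : ℝ) : ℂ) ^ (-a) / ((qNumber q k : ℝ) : ℂ) ^ a =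
      (((qNumber q (k + 1) : ℝ) : ℂ) ^ a)⁻¹ := by
  have h0 := one_le_qNumber hq0 hq1 hk
  have h1 := pow_div_qNumber_nonneg hq0 hq1 hk
  have e : qNumber q (k + 1) = (1 + q ^ k / qNumber q k) * qNumber q k := by
    rw [qNumber_succ hq1]
    field_simp
  rw [e, Complex.ofReal_mul, Complex.mul_cpow_ofReal_nonneg (by linarith) (by linarith), mul_inv,
    Complex.cpow_neg, div_eq_mul_inv]

theorem term_cons (q : ℝ) (s : Fin (r + 2) → ℂ) (m : ℕ) (k : Index (r + 1)) (hq0 : 0 < q) :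
    term q s (Index.cons m k) = (q : ℂ) ^ (((k.1 0 + 1 + m : ℕ) : ℂ) * s 0) /
      ((qNumber q (k.1 0 + 1 + m) : ℝ) : ℂ) ^ s 0 * term q (fun i => s i.succ) k := by
  have hq : (q : ℂ) ≠ 0 := by exact_mod_cast hq0.ne'
  simp only [term, Index.cons]
  rw [Fin.sum_univ_succ, Fin.prod_univ_succ]
  simp only [Fin.cons_zero, Fin.cons_succ]
  rw [Complex.cpow_add _ _ hq, mul_div_mul_comm]

theorem term_merge {q : ℝ} (hq0 : 0 < q) (hq1 : q < 1) (s : Fin (r + 2) → ℂ) (k : Index (r + 1)) :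
    term q (merge s 0) k = term q (fun i => s i.succ) k *
      ((q : ℂ) ^ ((k.1 0 : ℂ) * s 0) / ((qNumber q (k.1 0) : ℝ) : ℂ) ^ s 0) := by
  rw [← term_add_single hq0 hq1]
  congr 1
  ext i
  simp [merge_apply]

/-- The summand of the telescoping sum over the largest index. -/
def telescope (q : ℝ) (a : ℂ) (l m : ℕ) : ℂ :=
  (q : ℂ) ^ (((l + m : ℕ) : ℂ) * a) * (((qNumber q (l + m + 1) : ℝ) : ℂ) ^ a)⁻¹

theorem hasSum_telescope {q : ℝ} (hq0 : 0 < q) (hq1 : q < 1) {a : ℂ} (ha : 0 < a.re) (l : ℕ) :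
    HasSum (fun m => telescope q a l m - telescope q a l (m + 1)) (telescope q a l 0) := by
  have hs : Summable (telescope q a l) := by
    have hlt : q ^ a.re < 1 := Real.rpow_lt_one hq0.le hq1 ha
    have h0 : 0 ≤ q ^ a.re := Real.rpow_nonneg hq0.le _
    refine (summable_geometric_of_lt_one h0 hlt).of_norm_bounded fun m => ?_
    have h1 : 1 ≤ qNumber q (l + m + 1) := one_le_qNumber hq0 hq1 (by omega)
    rw [telescope, Complex.cpow_nat_mul, norm_mul, norm_pow, norm_qpow hq0, norm_inv,
      Complex.norm_cpow_eq_rpow_re_of_pos (by linarith)]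
    calc _ ≤ (q ^ a.re) ^ m * 1 := by
          refine mul_le_mul (pow_le_pow_of_le_one h0 hlt.le (by omega))
            (inv_le_one_of_one_le₀ (Real.one_le_rpow h1 ha.le)) ?_ (by positivity)
          exact inv_nonneg.2 (Real.rpow_nonneg (by linarith) _)
      _ = _ := mul_one _
  -- The family is summable by itself, so subtracting its own shift leaves the initial term.
  have h := hs.hasSum.sub ((hasSum_nat_add_iff' 1).2 hs.hasSum)
  simpa using h

/-- The factor q^(-s_1) lowers k_1 by one in the exponent, while (1+x)^(-s_1) raises it by one in
the q-number: these are consecutive values of one sequence. -/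
theorem telescope_sub {q : ℝ} (hq0 : 0 < q) (hq1 : q < 1) (s : Fin (r + 2) → ℂ) (m : ℕ)
    (k : Index (r + 1)) :
    ((q : ℂ) ^ (-s 0) - ((1 + ratio q (Index.cons m k) : ℝ) : ℂ) ^ (-s 0)) *
      term q s (Index.cons m k) =
    (telescope q (s 0) (k.1 0) m - telescope q (s 0) (k.1 0) (m + 1)) *
      term q (fun i => s i.succ) k := by
  have hq : (q : ℂ) ≠ 0 := by exact_mod_cast hq0.ne'
  rw [term_cons q s m k hq0, ← mul_assoc]
  congr 1
  have e := cpow_qNumber_succ hq0 hq1 (k := k.1 0 + 1 + m) (by omega) (s 0)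
  have h0 : (Index.cons m k).1 0 = k.1 0 + 1 + m := rfl
  rw [sub_mul, telescope, telescope, ratio, h0]
  congr 1
  · rw [← mul_div_assoc, ← Complex.cpow_add _ _ hq, div_eq_mul_inv,
      show k.1 0 + 1 + m = k.1 0 + m + 1 by ring]
    congr 2
    push_cast
    ring
  · rw [show k.1 0 + (m + 1) = k.1 0 + 1 + m by ring, ← e]
    ring

theorem coef_zero (a : ℂ) : coef a 0 = 1 := by
  simp [coef]

theorem leftTerm_eq (Z' : (Fin (r + 1) → ℂ) → ℂ) (k : ℕ) (s : Fin (r + 2) → ℂ) :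
    leftTerm Z' k s = (-1) ^ k * coef (s 0) k * Z' (merge s k) := by
  rw [leftTerm, coef, mul_div_assoc]

theorem rightTerm_eq (Z : (Fin (r + 2) → ℂ) → ℂ) (k : ℕ) (s : Fin (r + 2) → ℂ) :
    rightTerm Z k s = (-1) ^ k * coef (s 0) (k + 1) * Z (shift s (k + 1)) := by
  rw [rightTerm, coef, mul_div_assoc]

theorem merge_eq_add (s : Fin (r + 2) → ℂ) (k : ℕ) :
    merge s k = fun i => merge s 0 i + if i = 0 then (k : ℂ) else 0 := by
  simpa using merge_add s 0 k

theorem shift_eq_add (s : Fin (r + 2) → ℂ) (k : ℕ) :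
    shift s k = fun i => s i + if i = 0 then (k : ℂ) else 0 :=
  funext (shift_apply s k)

/-- The translation formula on the region of absolute convergence. -/
theorem translation_of_mem_region {q : ℝ} (hq0 : 0 < q) (hq1 : q < 1)
    {Z : (Fin (r + 2) → ℂ) → ℂ} {Z' : (Fin (r + 1) → ℂ) → ℂ}
    (hZ : ∀ s ∈ region (r + 2), HasSum (term q s) (Z s))
    (hZ' : ∀ s ∈ region (r + 1), HasSum (term q s) (Z' s))
    {s : Fin (r + 2) → ℂ} (hs : s ∈ region (r + 2)) :
    ∑' k, leftTerm Z' k s = ∑' k, rightTerm Z k s + ((q : ℂ) ^ (-s 0) - 1) * Z s := by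
  obtain ⟨S, hS1, hS2⟩ := exists_hasSum_binomial hq0 hq1 hZ' (merge_mem_region hs 0) (s 0)
  obtain ⟨T, hT1, hT2⟩ := exists_hasSum_binomial hq0 hq1 hZ hs (s 0)
  have hleft : HasSum (fun k => leftTerm Z' k s) S := by
    simp only [← merge_eq_add] at hS1
    simpa only [leftTerm_eq] using hS1
  -- The right-hand series is the full binomial series T without its term n = 0, which is Z s, and
  -- with opposite sign.
  have hright : HasSum (fun k => rightTerm Z k s) (Z s - T) := by
    have h := ((hasSum_nat_add_iff' 1).2 hT1).neg
    simp only [← shift_eq_add, Finset.sum_range_one, shift_zero, coef_zero, pow_zero, one_mul,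
      neg_sub] at h
    have e : ∀ k, -((-1) ^ (k + 1) * coef (s 0) (k + 1) * Z (shift s (k + 1))) =
        rightTerm Z k s := by
      intro k
      rw [rightTerm_eq]
      ring
    simpa only [e] using h
  have hs0 : 0 < (s 0).re := by
    have h := hs 0
    rwa [show Finset.Iic (0 : Fin (r + 2)) = {0} from rfl, Finset.sum_singleton] at h
  have h1 := ((hZ s hs).mul_left ((q : ℂ) ^ (-s 0))).sub hT2
  simp only [← sub_mul] at h1
  -- The gap m becomes the inner variable: for fixed (k_2, …, k_r) the sum over k_1 telescopes.
  have h2 := (Equiv.prodComm (Index (r + 1)) ℕ).hasSum_iff.2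
    ((Index.consEquiv r).hasSum_iff.2 h1)
  have h3 := h2.prod_fiberwise fun k => by
    have h := (hasSum_telescope hq0 hq1 hs0 (k.1 0)).mul_right (term q (fun i => s i.succ) k)
    simp only [← telescope_sub hq0 hq1] at h
    exact h
  have e : ∀ k : Index (r + 1), telescope q (s 0) (k.1 0) 0 * term q (fun i => s i.succ) k =
      ((1 + ratio q k : ℝ) : ℂ) ^ (-s 0) * term q (merge s 0) k := by
    intro k
    rw [term_merge hq0 hq1, telescope, add_zero, ← cpow_qNumber_succ hq0 hq1 (k.2.2 0), ratio]
    ring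
  simp only [e] at h3
  rw [hleft.tsum_eq, hright.tsum_eq, hS2.unique h3]
  ring

end Translation

/-! ### Normal convergence everywhere and analytic continuation of the identity. -/

section Global

variable {r : ℕ}

theorem differentiable_merge (k : ℕ) : Differentiable ℂ fun s : Fin (r + 2) → ℂ => merge s k := by
  refine differentiable_pi.2 fun i => ?_
  simp only [merge_apply]
  split_ifs <;> fun_prop

theorem differentiable_shift (k : ℕ) : Differentiable ℂ fun s : Fin (r + 2) → ℂ => shift s k := by
  refine differentiable_pi.2 fun i => ?_
  simp only [shift_apply]
  fun_prop

theorem holomorphicAt_coef_zero (a : ℂ) (k : ℕ) (s : Fin (r + 1) → ℂ) :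
    HolomorphicAt (fun z => a * coef (z 0) k) s := by
  have h : Differentiable ℂ fun z : Fin (r + 1) → ℂ => coef (z 0) k :=
    (differentiable_coef k).comp (differentiable_apply 0)
  exact (h.const_mul a).holomorphicAt

theorem holomorphicAt_leftTerm {Z' : (Fin (r + 1) → ℂ) → ℂ} {k : ℕ} {s : Fin (r + 2) → ℂ}
    (h : HolomorphicAt Z' (merge s k)) : HolomorphicAt (leftTerm Z' k) s := by
  rw [show leftTerm Z' k = _ from funext (leftTerm_eq Z' k)]
  exact (holomorphicAt_coef_zero _ k s).mul
    (h.comp (φ := fun s => merge s k) (differentiable_merge k))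

theorem holomorphicAt_rightTerm {Z : (Fin (r + 2) → ℂ) → ℂ} {k : ℕ} {s : Fin (r + 2) → ℂ}
    (h : HolomorphicAt Z (shift s (k + 1))) : HolomorphicAt (rightTerm Z k) s := by
  rw [show rightTerm Z k = _ from funext (rightTerm_eq Z k)]
  exact (holomorphicAt_coef_zero _ (k + 1) s).mul
    (h.comp (φ := fun s => shift s (k + 1)) (differentiable_shift (k + 1)))

theorem meromorphic_leftTerm {Z' : (Fin (r + 1) → ℂ) → ℂ} (hZ' : Meromorphic Z') (k : ℕ) :
    Meromorphic (leftTerm Z' k) := by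
  intro p
  rw [show leftTerm Z' k = _ from funext (leftTerm_eq Z' k)]
  refine IsMeromorphicAt.mul (holomorphicAt_coef_zero _ k p).isMeromorphicAt
    (IsMeromorphicAt.comp (hZ' _) (differentiable_merge k)
      -- A section of merging through p: the second coordinate is frozen at its value at p and the
      -- first absorbs the difference.
      (σ := fun w => Fin.cons (w 0 - p 1 - k) (Fin.cons (p 1) fun i : Fin r => w i.succ))
      ?_ ?_ ?_)
  · refine continuous_pi fun i => ?_
    refine Fin.cases ?_ (fun i => Fin.cases ?_ (fun i => ?_) i) i
    · simp only [Fin.cons_zero]; fun_prop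
    · simp only [Fin.cons_succ, Fin.cons_zero]; fun_prop
    · simp only [Fin.cons_succ]; fun_prop
  · ext i
    refine Fin.cases ?_ (fun i => Fin.cases ?_ (fun i => ?_) i) i
    · simp only [merge, Fin.cons_zero]
      ring
    · simp
    · simp [merge]
  · intro w
    ext i
    refine Fin.cases ?_ (fun i => ?_) i
    · have : (1 : Fin (r + 2)) = Fin.succ 0 := rfl
      simp only [merge, this, Fin.cons_zero, Fin.cons_succ]
      ring
    · simp [merge]

theorem meromorphic_rightTerm {Z : (Fin (r + 2) → ℂ) → ℂ} (hZ : Meromorphic Z) (k : ℕ) :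
    Meromorphic (rightTerm Z k) := by
  intro p
  rw [show rightTerm Z k = _ from funext (rightTerm_eq Z k)]
  refine IsMeromorphicAt.mul (holomorphicAt_coef_zero _ (k + 1) p).isMeromorphicAt
    (IsMeromorphicAt.comp (hZ _) (differentiable_shift (k + 1))
      (σ := fun w i => w i - if i = 0 then ((k + 1 : ℕ) : ℂ) else 0) (by fun_prop) ?_ ?_)
  · ext i
    simp [shift_apply]
  · intro w
    ext i
    simp [shift_apply]

theorem normallySummableOn_leftTerm {q : ℝ} (hq0 : 0 < q) (hq1 : q < 1)
    {Z' : (Fin (r + 1) → ℂ) → ℂ} (hZ' : ∀ s ∈ region (r + 1), HasSum (term q s) (Z' s))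
    {K : Set (Fin (r + 2) → ℂ)} (hK : IsCompact K) {k₀ : ℕ}
    (hk : ∀ s ∈ K, merge s k₀ ∈ region (r + 1)) :
    NormallySummableOn (fun k => leftTerm Z' (k₀ + k)) K := by
  refine normallySummableOn_of_coef hq0 hq1 hZ' hK (differentiable_merge k₀).continuous hk k₀
    fun n s _ => ?_
  rw [leftTerm_eq, merge_add, add_comm n]
  simp

theorem normallySummableOn_rightTerm {q : ℝ} (hq0 : 0 < q) (hq1 : q < 1)
    {Z : (Fin (r + 2) → ℂ) → ℂ} (hZ : ∀ s ∈ region (r + 2), HasSum (term q s) (Z s))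
    {K : Set (Fin (r + 2) → ℂ)} (hK : IsCompact K) {k₀ : ℕ}
    (hk : ∀ s ∈ K, shift s (k₀ + 1) ∈ region (r + 2)) :
    NormallySummableOn (fun k => rightTerm Z (k₀ + k)) K := by
  refine normallySummableOn_of_coef hq0 hq1 hZ hK (differentiable_shift (k₀ + 1)).continuous hk
    (k₀ + 1) fun n s _ => ?_
  rw [rightTerm_eq, add_right_comm, shift_add, add_comm n]
  simp

/-- On a compact set, all sufficiently large translations lead into the region. -/
theorem exists_forall_mem_region {K : Set (Fin (r + 2) → ℂ)} (hK : IsCompact K) :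
    ∃ k₀ : ℕ, ∀ k, k₀ ≤ k → ∀ s ∈ K, merge s k ∈ region (r + 1) ∧ shift s k ∈ region (r + 2) := by
  obtain ⟨R, hR⟩ := hK.isBounded.exists_norm_le
  -- Each partial sum has modulus at most (r+2)R on K, so adding more than this makes its real part
  -- positive.
  obtain ⟨k₀, hk₀⟩ := exists_nat_gt ((r + 2 : ℕ) * R)
  refine ⟨k₀, fun k hk s hs => ?_⟩
  have hR0 : 0 ≤ R := (norm_nonneg s).trans (hR s hs)
  have hk' : (k₀ : ℝ) ≤ k := by exact_mod_cast hk
  have key : ∀ j : Fin (r + 2), 0 < (∑ i ∈ Finset.Iic j, s i + (k : ℂ)).re := by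
    intro j
    have h1 := norm_sum_Iic_le hR0 (fun i => (norm_le_pi_norm s i).trans (hR s hs)) j
    have h2 := (abs_le.1 (Complex.abs_re_le_norm (∑ i ∈ Finset.Iic j, s i))).1
    rw [Complex.add_re, Complex.natCast_re]
    linarith
  constructor
  · intro j
    rw [sum_Iic_merge]
    exact key j.succ
  · intro j
    rw [sum_Iic_shift]
    exact key j

theorem exists_normal_tail {q : ℝ} (hq0 : 0 < q) (hq1 : q < 1)
    {Z : (Fin (r + 2) → ℂ) → ℂ} {Z' : (Fin (r + 1) → ℂ) → ℂ}
    (hZ : ∀ s ∈ region (r + 2), HasSum (term q s) (Z s))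
    (hZ' : ∀ s ∈ region (r + 1), HasSum (term q s) (Z' s))
    {K : Set (Fin (r + 2) → ℂ)} (hK : IsCompact K) :
    ∃ k₀ : ℕ,
      (∀ k, k₀ ≤ k → ∀ s ∈ K, HolomorphicAt (leftTerm Z' k) s ∧ HolomorphicAt (rightTerm Z k) s) ∧
      NormallySummableOn (fun k => leftTerm Z' (k₀ + k)) K ∧
      NormallySummableOn (fun k => rightTerm Z (k₀ + k)) K := by
  obtain ⟨k₀, hk₀⟩ := exists_forall_mem_region hK
  refine ⟨k₀, fun k hk s hs => ⟨?_, ?_⟩,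
    normallySummableOn_leftTerm hq0 hq1 hZ' hK fun s hs => (hk₀ k₀ le_rfl s hs).1,
    normallySummableOn_rightTerm hq0 hq1 hZ hK fun s hs => (hk₀ (k₀ + 1) (by omega) s hs).2⟩
  · exact holomorphicAt_leftTerm (holomorphicAt_of_hasSum_term hq0 hq1 hZ' (hk₀ k hk s hs).1)
  · exact holomorphicAt_rightTerm
      (holomorphicAt_of_hasSum_term hq0 hq1 hZ (hk₀ (k + 1) (by omega) s hs).2)

/-- The translation formula at all points where the functions in it are holomorphic. -/
theorem translation_of_holomorphicAt {q : ℝ} (hq0 : 0 < q) (hq1 : q < 1)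
    {Z : (Fin (r + 2) → ℂ) → ℂ} {Z' : (Fin (r + 1) → ℂ) → ℂ}
    (hZ : IsMeromorphicContinuation q (r + 2) Z) (hZ' : IsMeromorphicContinuation q (r + 1) Z')
    (hL : IsNormalSeries (leftTerm Z')) (hR : IsNormalSeries (rightTerm Z))
    {s : Fin (r + 2) → ℂ} (hs' : ∀ k : ℕ, HolomorphicAt Z' (merge s k))
    (hs : ∀ k : ℕ, HolomorphicAt Z (shift s k)) :
    ∑' k, leftTerm Z' k s = ∑' k, rightTerm Z k s + ((q : ℂ) ^ (-s 0) - 1) * Z s := by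
  have hq : (q : ℂ) ≠ 0 := by exact_mod_cast hq0.ne'
  have hpre : Differentiable ℂ fun z : Fin (r + 2) → ℂ => (q : ℂ) ^ (-z 0) - 1 := by
    have : Differentiable ℂ fun z : Fin (r + 2) → ℂ => -z 0 := by fun_prop
    exact (this.const_cpow (Or.inl hq)).sub_const 1
  let Φ : (Fin (r + 2) → ℂ) → ℂ := fun z => ∑' k, leftTerm Z' k z +
    -1 * (∑' k, rightTerm Z k z + ((q : ℂ) ^ (-z 0) - 1) * Z z)
  have hneg : ∀ p : Fin (r + 2) → ℂ, HolomorphicAt (fun _ => (-1 : ℂ)) p := fun p =>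
    (differentiable_const (-1 : ℂ)).holomorphicAt
  have hmer : Meromorphic Φ := fun p =>
    (hL.isMeromorphicAt_tsum fun k => meromorphic_leftTerm hZ'.1 k p).add
      ((hneg p).isMeromorphicAt.mul
        ((hR.isMeromorphicAt_tsum fun k => meromorphic_rightTerm hZ.1 k p).add
          (hpre.holomorphicAt.isMeromorphicAt.mul (hZ.1 p))))
  have hhol : HolomorphicAt Φ s :=
    (hL.holomorphicAt_tsum fun k => holomorphicAt_leftTerm (hs' k)).add
      ((hneg s).mul ((hR.holomorphicAt_tsum fun k => holomorphicAt_rightTerm (hs (k + 1))).add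
        (hpre.holomorphicAt.mul (by simpa using hs 0))))
  have hdense := hmer.dense_zeros (isOpen_region (r + 2)) (nonempty_region (r + 2)) fun z hz => by
    simp only [Φ]
    rw [translation_of_mem_region hq0 hq1 hZ.2 hZ'.2 hz]
    ring
  -- Φ is continuous at s, so a nonzero value there would persist nearby and contradict the density
  -- of the zeros.
  have h0 : Φ s = 0 := by
    by_contra hne
    obtain ⟨z, hz, hz0⟩ := (mem_closure_iff_frequently.1 (hdense s)).and_eventually
      (hhol.differentiableAt.continuousAt.eventually_ne hne) |>.exists
    exact hz0 hz
  simp only [Φ] at h0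
  linear_combination h0

end Global

end

end QMZV

/-- The depth is `r + 2`, so it runs over all integers at least `2`. -/
theorem mainTheorem1 (q : ℝ) (hq0 : 0 < q) (hq1 : q < 1) (r : ℕ) :
    -- meromorphic continuations exist, in this depth and in the depth one less
    (∃ Z : (Fin (r + 2) → ℂ) → ℂ, QMZV.IsMeromorphicContinuation q (r + 2) Z) ∧
    (∃ Z' : (Fin (r + 1) → ℂ) → ℂ, QMZV.IsMeromorphicContinuation q (r + 1) Z') ∧
    ∀ (Z : (Fin (r + 2) → ℂ) → ℂ) (Z' : (Fin (r + 1) → ℂ) → ℂ),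
      QMZV.IsMeromorphicContinuation q (r + 2) Z →
      QMZV.IsMeromorphicContinuation q (r + 1) Z' →
      -- the translation formula, wherever all the functions in it are holomorphic
      (∀ s : Fin (r + 2) → ℂ,
        (∀ k : ℕ, QMZV.HolomorphicAt Z' (QMZV.merge s k)) →
        (∀ k : ℕ, QMZV.HolomorphicAt Z (QMZV.shift s k)) →
        Summable (fun k : ℕ => QMZV.leftTerm Z' k s) ∧
        Summable (fun k : ℕ => QMZV.rightTerm Z k s) ∧
        ∑' k : ℕ, QMZV.leftTerm Z' k s =
          ∑' k : ℕ, QMZV.rightTerm Z k s + ((q : ℂ) ^ (-s 0) - 1) * Z s) ∧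
      -- normal convergence of both series on compact subsets of the region `U_r`
      (∀ K : Set (Fin (r + 2) → ℂ), IsCompact K → K ⊆ QMZV.region (r + 2) →
        QMZV.NormallySummableOn (QMZV.leftTerm Z') K ∧
        QMZV.NormallySummableOn (QMZV.rightTerm Z) K) ∧
      -- normal convergence as series of meromorphic functions on all of `ℂ^r`
      (∀ K : Set (Fin (r + 2) → ℂ), IsCompact K →
        ∃ k₀ : ℕ,
          (∀ k, k₀ ≤ k → ∀ s ∈ K, QMZV.HolomorphicAt (QMZV.leftTerm Z' k) s ∧
            QMZV.HolomorphicAt (QMZV.rightTerm Z k) s) ∧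
          QMZV.NormallySummableOn (fun k => QMZV.leftTerm Z' (k₀ + k)) K ∧
          QMZV.NormallySummableOn (fun k => QMZV.rightTerm Z (k₀ + k)) K) := by
  refine ⟨⟨_, QMZV.isMeromorphicContinuation_continuation hq0 hq1 (r + 1)⟩,
    ⟨_, QMZV.isMeromorphicContinuation_continuation hq0 hq1 r⟩, fun Z Z' hZ hZ' => ?_⟩
  have htail := fun K (hK : IsCompact K) => QMZV.exists_normal_tail hq0 hq1 hZ.2 hZ'.2 (K := K) hK
  have hL : QMZV.IsNormalSeries (QMZV.leftTerm Z') := fun K hK => by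
    obtain ⟨k₀, h1, h2, -⟩ := htail K hK
    exact ⟨k₀, fun k hk s hs => (h1 k hk s hs).1, h2⟩
  have hR : QMZV.IsNormalSeries (QMZV.rightTerm Z) := fun K hK => by
    obtain ⟨k₀, h1, -, h2⟩ := htail K hK
    exact ⟨k₀, fun k hk s hs => (h1 k hk s hs).2, h2⟩
  refine ⟨fun s hs' hs => ⟨hL.summable s, hR.summable s,
    QMZV.translation_of_holomorphicAt hq0 hq1 hZ hZ' hL hR hs' hs⟩, fun K hK hKr => ?_, htail⟩
  constructor
  · simpa using QMZV.normallySummableOn_leftTerm hq0 hq1 hZ'.2 hK (k₀ := 0)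
      fun s hs => QMZV.merge_mem_region (hKr hs) 0
  · simpa using QMZV.normallySummableOn_rightTerm hq0 hq1 hZ.2 hK (k₀ := 0)
      fun s hs => QMZV.shift_mem_region (hKr hs) _
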